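/- We work in many-sorted first-order logic with equality. A signature $\Sigma$ has a nonempty set $\mathcal S_\Sigma$ of sorts, function symbols of arities $(\sigma_1,\dots,\sigma_n,\sigma)$ and predicate symbols of arities $(\sigma_1,\dots,\sigma_n)$ with $n\ge 0$, and an equality symbol for every sort; structures interpret sorts as nonempty sets and equality as identity; a $\Sigma$-interpretation is a $\Sigma$-structure together with an assignment of all variables (countably many of each sort); a $\Sigma$-theory $\mathcal T$ is a set of $\Sigma$-sentences, and a $\mathcal T$-interpretation is an interpretation satisfying all of them. A formula is $\mathcal T$-satisfiable if some $\mathcal T$-interpretation satisfies it. Two signatures are disjoint if they share at most sorts and equality symbols; $\Sigma_1\cup\Sigma_2$ is the union signature, and $\mathcal T_1\cup\mathcal T_2$ is the $(\Sigma_1\cup\Sigma_2)$-theory whose axioms are the union of those of $\mathcal T_1$ and $\mathcal T_2$. Let $S\subseteq\mathcal S_\Sigma$ be finite. - $\mathcal T$ is *stably finite* with respect to $S$ if for every quantifier-free formula $\varphi$ and every $\mathcal T$-interpretation $\mathcal A$ satisfying $\varphi$ there is a $\mathcal T$-interpretation $\mathcal B$ satisfying $\varphi$ with $|\sigma^{\mathcal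 B}|\le|\sigma^{\mathcal A}|$ and $|\sigma^{\mathcal B}|<\aleph_0$ for every $\sigma\in S$. - $\mathcal T$ is *finitely smooth* with respect to $S$ if for every quantifier-free formula $\varphi$, every $\mathcal T$-interpretation $\mathcal A$ satisfying $\varphi$, and every function $\kappa$ assigning to each $\sigma\in S$ with $|\sigma^{\mathcal A}|<\aleph_0$ a cardinal with $|\sigma^{\mathcal A}|\le\kappa(\sigma)<\aleph_0$, there is a $\mathcal T$-interpretation $\mathcal B$ satisfying $\varphi$ with $|\sigma^{\mathcal B}|=\kappa(\sigma)$ for all these $\sigma$. - For $S=\{\sigma_1,\dots,\sigma_n\}$ and a quantifier-free $\varphi$, $\mathrm{minmods}_{\mathcal T,S}(\varphi)$ is the (finite) set of the tuples that are minimal, in the product order, among the tuples $(|\sigma_1^{\mathcal A}|,\dots,|\sigma_n^{\mathcal A}|)$ of $\mathcal T$-interpretations $\mathcal A$ satisfying $\varphi$. If $\mathcal T$ is stably finite with respect to $S$, these are tuples of natural numbers, and the function $\mathrm{minmods}_{\mathcal T,S}$ is *computable* if a list of the elements of $\mathrm{minmods}_{\mathcal T,S}(\varphi)$ can be computed from $\varphi$.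 For computability, the sorts and symbols of a countable signature are named by natural numbers in an arbitrary way, symbols are written together with their arities, and formulas are represented by their Gödel numbers. The satisfiability problem for quantifier-free formulas of $\mathcal T$ is *decidable* if the set of Gödel numbers of $\mathcal T$-satisfiable quantifier-free formulas is computable. **Corollary.** Let $\Sigma_1$ and $\Sigma_2$ be disjoint countable signatures, where $\mathcal S_{\Sigma_1}$ and $\mathcal S_{\Sigma_2}$ are finite. Let $\mathcal T_1$ and $\mathcal T_2$ be $\Sigma_1$- and $\Sigma_2$-theories respectively, and assume that the satisfiability problems for quantifier-free formulas of both $\mathcal T_1$ and $\mathcal T_2$ are decidable. Suppose that $\mathcal T_1$ is stably finite and finitely smooth, both with respect to $\mathcal S_{\Sigma_1}\cap\mathcal S_{\Sigma_2}$, and that $\mathrm{minmods}_{\mathcal T_1,\mathcal S_{\Sigma_1}\cap\mathcal S_{\Sigma_2}}$ is computable. Then the satisfiability problem for quantifier-free formulas of $\mathcal T_1\cup\mathcal T_2$ is decidable. -/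

import Mathlib

universe u

namespace ManySorted

/-! ## Signatures

Sorts and symbols are named by natural numbers. Since the names are arbitrary, every countable
many-sorted signature with finitely many sorts is of the form below, for every naming of its sorts
and symbols by natural numbers. -/

/-- A function symbol: a name together with its arity `(dom₁, …, domₙ, cod)`, `n ≥ 0`. -/
structure FunSym where
  name : ℕ
  dom : List ℕ
  cod : ℕ

/-- A predicate symbol other than equality: a name together with its arity
`(dom₁, …, domₙ)`, `n ≥ 0`. -/
structure PredSym where
  name : ℕ
  dom : List ℕ

/-- A (countable, many-sorted) signature with finitely many sorts. The equality symbols, one for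
each sort, are implicit. -/
structure Signature where
  sorts : Finset ℕ
  sorts_nonempty : sorts.Nonempty
  funs : Set FunSym
  preds : Set PredSym
  dom_funs : ∀ f ∈ funs, ∀ s ∈ f.dom, s ∈ sorts
  cod_funs : ∀ f ∈ funs, f.cod ∈ sorts
  dom_preds : ∀ P ∈ preds, ∀ s ∈ P.dom, s ∈ sorts

/-- Two signatures are disjoint if they share at most sorts and equality symbols. -/
def Signature.IsDisjoint (L₁ L₂ : Signature) : Prop :=
  Disjoint L₁.funs L₂.funs ∧ Disjoint L₁.preds L₂.preds

/-- Inclusion of signatures. -/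
structure Signature.Sub (L L' : Signature) : Prop where
  sorts : L.sorts ⊆ L'.sorts
  funs : L.funs ⊆ L'.funs
  preds : L.preds ⊆ L'.preds

/-- The union `L₁ ∪ L₂` of two signatures. -/
def Signature.union (L₁ L₂ : Signature) : Signature where
  sorts := L₁.sorts ∪ L₂.sorts
  sorts_nonempty := L₁.sorts_nonempty.mono Finset.subset_union_left
  funs := L₁.funs ∪ L₂.funs
  preds := L₁.preds ∪ L₂.preds
  dom_funs := fun f hf s hs => Finset.mem_union.2 <|
    hf.imp (fun h => L₁.dom_funs f h s hs) (fun h => L₂.dom_funs f h s hs)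
  cod_funs := fun f hf => Finset.mem_union.2 <| hf.imp (L₁.cod_funs f) (L₂.cod_funs f)
  dom_preds := fun P hP s hs => Finset.mem_union.2 <|
    hP.imp (fun h => L₁.dom_preds P h s hs) (fun h => L₂.dom_preds P h s hs)

theorem Signature.sub_union_left (L₁ L₂ : Signature) : L₁.Sub (L₁.union L₂) :=
  ⟨Finset.subset_union_left, Set.subset_union_left, Set.subset_union_left⟩

theorem Signature.sub_union_right (L₁ L₂ : Signature) : L₂.Sub (L₁.union L₂) :=
  ⟨Finset.subset_union_right, Set.subset_union_right, Set.subset_union_right⟩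

/-! ## Terms and formulas -/

/-- `L`-terms of a given sort. There are countably many variables `var s _ 0, var s _ 1, …` of
each sort `s` of `L`. -/
inductive Term (L : Signature) : ℕ → Type
  | var (s : ℕ) (hs : s ∈ L.sorts) (i : ℕ) : Term L s
  | app (f : FunSym) (hf : f ∈ L.funs)
      (args : (i : Fin f.dom.length) → Term L (f.dom.get i)) : Term L f.cod

/-- First-order `L`-formulas, over the connectives `¬`, `∧` and the quantifier `∀`. -/
inductive Formula (L : Signature) : Type
  | eq (s : ℕ) (hs : s ∈ L.sorts) (t t' : Term L s) : Formula L
  | rel (P : PredSym) (hP : P ∈ L.preds)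
      (args : (i : Fin P.dom.length) → Term L (P.dom.get i)) : Formula L
  | neg (φ : Formula L) : Formula L
  | and (φ ψ : Formula L) : Formula L
  | all (s : ℕ) (hs : s ∈ L.sorts) (i : ℕ) (φ : Formula L) : Formula L

variable {L L' L₁ L₂ : Signature}

/-- The variables of a term; the variable `var s _ i` is represented by `(s, i)`. -/
def Term.vars : {s : ℕ} → Term L s → Set (ℕ × ℕ)
  | _, .var s _ i => {(s, i)}
  | _, .app _ _ args => ⋃ i, (args i).vars

/-- The free variables of a formula. -/
def Formula.freeVars : Formula L → Set (ℕ × ℕ)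
  | .eq _ _ t t' => t.vars ∪ t'.vars
  | .rel _ _ args => ⋃ i, (args i).vars
  | .neg φ => φ.freeVars
  | .and φ ψ => φ.freeVars ∪ ψ.freeVars
  | .all s _ i φ => φ.freeVars \ {(s, i)}

/-- Quantifier-free formulas. -/
def Formula.IsQF : Formula L → Prop
  | .eq _ _ _ _ => True
  | .rel _ _ _ => True
  | .neg φ => φ.IsQF
  | .and φ ψ => φ.IsQF ∧ ψ.IsQF
  | .all _ _ _ _ => False

/-- A term over `L`, read as a term over a larger signature. -/
def Term.incl (h : L.Sub L') : {s : ℕ} → Term L s → Term L' s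
  | _, .var s hs i => .var s (h.sorts hs) i
  | _, .app f hf args => .app f (h.funs hf) fun i => (args i).incl h

/-- A formula over `L`, read as a formula over a larger signature. -/
def Formula.incl (h : L.Sub L') : Formula L → Formula L'
  | .eq s hs t t' => .eq s (h.sorts hs) (t.incl h) (t'.incl h)
  | .rel P hP args => .rel P (h.preds hP) fun i => (args i).incl h
  | .neg φ => .neg (φ.incl h)
  | .and φ ψ => .and (φ.incl h) (ψ.incl h)
  | .all s hs i φ => .all s (h.sorts hs) i (φ.incl h)

theorem Term.vars_incl (h : L.Sub L') {s : ℕ} (t : Term L s) : (t.incl h).vars = t.vars := by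
  induction t with
  | var s hs i => rfl
  | app f hf args ih => simp only [Term.incl, Term.vars, ih]

theorem Formula.freeVars_incl (h : L.Sub L') (φ : Formula L) :
    (φ.incl h).freeVars = φ.freeVars := by
  induction φ with
  | eq s hs t t' => simp only [Formula.incl, Formula.freeVars, Term.vars_incl]
  | rel P hP args => simp only [Formula.incl, Formula.freeVars, Term.vars_incl]
  | neg φ ih => simp only [Formula.incl, Formula.freeVars, ih]
  | and φ ψ ih₁ ih₂ => simp only [Formula.incl, Formula.freeVars, ih₁, ih₂]
  | all s hs i φ ih => simp only [Formula.incl, Formula.freeVars, ih]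

/-- An `L`-sentence is an `L`-formula without free variables. -/
abbrev Sentence (L : Signature) : Type := {φ : Formula L // φ.freeVars = ∅}

/-- A sentence over `L`, read as a sentence over a larger signature. -/
def Sentence.incl (h : L.Sub L') (φ : Sentence L) : Sentence L' :=
  ⟨φ.1.incl h, (Formula.freeVars_incl h φ.1).trans φ.2⟩

/-- An `L`-theory is a set of `L`-sentences, its axioms. -/
abbrev Theory (L : Signature) : Type := Set (Sentence L)

/-- The `(L₁ ∪ L₂)`-theory whose axioms are those of `T₁` and those of `T₂`. -/
def Theory.union (T₁ : Theory L₁) (T₂ : Theory L₂) : Theory (L₁.union L₂) :=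
  Sentence.incl (L₁.sub_union_left L₂) '' T₁ ∪ Sentence.incl (L₁.sub_union_right L₂) '' T₂

/-! ## Semantics -/

/-- An `L`-structure. Only the values of `carrier` at the sorts of `L` matter. -/
structure Structure (L : Signature) where
  carrier : ℕ → Type u
  carrier_nonempty : ∀ s ∈ L.sorts, Nonempty (carrier s)
  fn : (f : FunSym) → f ∈ L.funs →
    ((i : Fin f.dom.length) → carrier (f.dom.get i)) → carrier f.cod
  pred : (P : PredSym) → P ∈ L.preds →
    ((i : Fin P.dom.length) → carrier (P.dom.get i)) → Prop

/-- An assignment maps each variable of sort `s` to an element of the domain of `s`. -/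
def Assignment (A : Structure.{u} L) : Type u :=
  (s : ℕ) → s ∈ L.sorts → ℕ → A.carrier s

/-- Change the value of an assignment at the variable `(s, i)` to `a`. -/
def Assignment.update {A : Structure.{u} L} (ν : Assignment A) (s i : ℕ) (a : A.carrier s) :
    Assignment A :=
  fun s' hs' j => if h : s = s' ∧ j = i then h.1 ▸ a else ν s' hs' j

/-- The value of a term. -/
def Term.eval (A : Structure.{u} L) (ν : Assignment A) : {s : ℕ} → Term L s → A.carrier s
  | _, .var s hs i => ν s hs i
  | _, .app f hf args => A.fn f hf fun i => (args i).eval A ν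

/-- Truth of a formula in a structure under an assignment. -/
def Formula.Realize (A : Structure.{u} L) : Formula L → Assignment A → Prop
  | .eq _ _ t t', ν => t.eval A ν = t'.eval A ν
  | .rel P hP args, ν => A.pred P hP fun i => (args i).eval A ν
  | .neg φ, ν => ¬ φ.Realize A ν
  | .and φ ψ, ν => φ.Realize A ν ∧ ψ.Realize A ν
  | .all s _ i φ, ν => ∀ a : A.carrier s, φ.Realize A (ν.update s i a)

/-- An `L`-interpretation is a structure together with an assignment. -/
structure Interpretation (L : Signature) where
  str : Structure.{u} L
  asg : Assignment str

/-- The cardinality of the domain of the sort `s`. -/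
def Interpretation.card (A : Interpretation.{u} L) (s : ℕ) : Cardinal.{u} :=
  Cardinal.mk (A.str.carrier s)

/-- The interpretation `A` satisfies the formula `φ`. -/
def Interpretation.Satisfies (A : Interpretation.{u} L) (φ : Formula L) : Prop :=
  φ.Realize A.str A.asg

/-- `A` is a `T`-interpretation. -/
def Interpretation.Models (A : Interpretation.{u} L) (T : Theory L) : Prop :=
  ∀ ψ ∈ T, A.Satisfies ψ.1

/-- `φ` is `T`-satisfiable. -/
def Theory.Satisfiable (T : Theory L) (φ : Formula L) : Prop :=
  ∃ A : Interpretation.{u} L, A.Models T ∧ A.Satisfies φ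

/-- `T` is stably finite with respect to the set `S` of sorts. -/
def Theory.StablyFinite (T : Theory L) (S : Finset ℕ) : Prop :=
  ∀ φ : Formula L, φ.IsQF → ∀ A : Interpretation.{u} L, A.Models T → A.Satisfies φ →
    ∃ B : Interpretation.{u} L, B.Models T ∧ B.Satisfies φ ∧
      ∀ s ∈ S, B.card s ≤ A.card s ∧ B.card s < Cardinal.aleph0

/-- `T` is finitely smooth with respect to the set `S` of sorts. Only the values of `κ` at those
sorts in `S` whose domain in `A` is finite matter. -/
def Theory.FinitelySmooth (T : Theory L) (S : Finset ℕ) : Prop :=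
  ∀ φ : Formula L, φ.IsQF → ∀ A : Interpretation.{u} L, A.Models T → A.Satisfies φ →
    ∀ κ : ℕ → Cardinal.{u},
      (∀ s ∈ S, A.card s < Cardinal.aleph0 → A.card s ≤ κ s ∧ κ s < Cardinal.aleph0) →
      ∃ B : Interpretation.{u} L, B.Models T ∧ B.Satisfies φ ∧
        ∀ s ∈ S, A.card s < Cardinal.aleph0 → B.card s = κ s

/-- The `S`-size of an interpretation: the tuple of the cardinalities of the domains of the sorts
in `S`, where `S = {σ₁ < σ₂ < ⋯}` is enumerated increasingly. -/
def Interpretation.size (A : Interpretation.{u} L) (S : Finset ℕ) : Fin S.card → Cardinal.{u} :=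
  fun i => A.card (S.orderEmbOfFin rfl i)

/-- The set of the minimal `S`-sizes (in the product order) of the `T`-interpretations that
satisfy `φ`. -/
def Theory.minmods (T : Theory L) (S : Finset ℕ) (φ : Formula L) :
    Set (Fin S.card → Cardinal.{u}) :=
  {k | Minimal (fun k' => ∃ A : Interpretation.{u} L,
    A.Models T ∧ A.Satisfies φ ∧ A.size S = k') k}

/-! ## Gödel numbers and computability -/

/-- The code of a function symbol. -/
def FunSym.code (f : FunSym) : ℕ := Encodable.encode (f.name, f.dom, f.cod)

/-- The code of a predicate symbol. -/
def PredSym.code (P : PredSym) : ℕ := Encodable.encode (P.name, P.dom)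

/-- The Gödel number of a term. -/
def Term.code : {s : ℕ} → Term L s → ℕ
  | _, .var s _ i => Nat.pair 0 (Nat.pair s i)
  | _, .app f _ args =>
      Nat.pair 1 (Nat.pair f.code (Encodable.encode (List.ofFn fun i => (args i).code)))

/-- The Gödel number of a formula. -/
def Formula.code : Formula L → ℕ
  | .eq s _ t t' => Nat.pair 0 (Nat.pair s (Nat.pair t.code t'.code))
  | .rel P _ args =>
      Nat.pair 1 (Nat.pair P.code (Encodable.encode (List.ofFn fun i => (args i).code)))
  | .neg φ => Nat.pair 2 φ.code
  | .and φ ψ => Nat.pair 3 (Nat.pair φ.code ψ.code)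
  | .all s _ i φ => Nat.pair 4 (Nat.pair (Nat.pair s i) φ.code)

/-- The satisfiability problem for quantifier-free formulas of `T` is decidable: the set of the
Gödel numbers of the `T`-satisfiable quantifier-free `L`-formulas is computable. -/
def Theory.QFSatDecidable (T : Theory L) : Prop :=
  ComputablePred fun n : ℕ => ∃ φ : Formula L, φ.IsQF ∧ φ.code = n ∧ T.Satisfiable.{u} φ

/-- The function `minmods T S` is computable: from the Gödel number of a quantifier-free formula
one can compute a list of the elements of the finite set `minmods T S φ`. (If `T` is stably finite
with respect to `S`, then these are tuples of natural numbers.) -/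
def Theory.MinmodsComputable (T : Theory L) (S : Finset ℕ) : Prop :=
  ∃ m : ℕ → List (Fin S.card → ℕ), Computable m ∧
    ∀ φ : Formula L, φ.IsQF →
      Theory.minmods.{u} T S φ = {k | ∃ v ∈ m φ.code, k = fun i => (v i : Cardinal.{u})}

end ManySorted

namespace ManySorted

variable {L L' L₁ L₂ : Signature}

/-! ## Gödel numbers determine terms and formulas -/

/-! The argument is a Nelson–Oppen combination in which cardinalities are negotiated through minimal
models. Let φ be a quantifier-free formula over `L₁.union L₂` with Gödel number n. Every term of φ
is named by the variable whose index is the code of that term. Adding the definitions of these names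
(`flatDefs`) and guessing a truth value for every flat atom (`valuations`) replaces φ by literals
with at most one symbol besides equality, so each of them is a literal over L₁ or over L₂. Let Γ₁
and Γ₂ be the conjunctions of those over L₁ and over L₂; both fix which shared variables of index at
most n are equal. A guess is accepted if it makes φ true and if, for some v in the minmods of Γ₁,
the formula Γ₂ together with "at least v i elements in the i-th shared sort" is T₂-satisfiable
(`decideUnion`).

Completeness (`decideUnion_of_satisfiable`): a model of the union dictates the guess. Its L₁-reduct
satisfies Γ₁, so its size lies above a minimal tuple v, and its L₂-reduct therefore has the elements
demanded by v.

Soundness (`satisfiable_of_decideUnion`): acceptance yields a T₁-model A of finite size v and a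
T₂-model B that is at least as large on the shared sorts. Finite smoothness reaches finite sizes
only, so `Theory.FinitelySmooth.exists_card_eq_min` combines it with an ultraproduct and with
Löwenheim–Skolem to give A the size min(|B|, ℵ₀) in every shared sort. B is cut down to countable
domains as well, and `exists_amalgam` glues the two along bijections that respect the named
elements.

The signatures themselves are not given as decidable. In a theory with a model, c codes a
quantifier-free formula exactly when ¬(c ∧ ¬c) codes a satisfiable one, so `exists_isDecider`
extracts well-formedness from satisfiability. If the union has no model, there is nothing to decide.
-/

theorem FunSym.code_injective : Function.Injective FunSym.code := by
  rintro ⟨n, d, c⟩ ⟨n', d', c'⟩ h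
  have := Encodable.encode_injective h
  simp_all

theorem PredSym.code_injective : Function.Injective PredSym.code := by
  rintro ⟨n, d⟩ ⟨n', d'⟩ h
  have := Encodable.encode_injective h
  simp_all

instance : Countable FunSym := FunSym.code_injective.countable

theorem Term.sort_mem {s : ℕ} (t : Term L s) : s ∈ L.sorts := by
  cases t with
  | var s hs i => exact hs
  | app f hf args => exact L.cod_funs f hf

theorem Signature.get_dom_fun_mem (L : Signature) {f : FunSym} (hf : f ∈ L.funs)
    (i : Fin f.dom.length) : f.dom.get i ∈ L.sorts :=
  L.dom_funs f hf _ (List.get_mem _ _)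

theorem Signature.get_dom_pred_mem (L : Signature) {P : PredSym} (hP : P ∈ L.preds)
    (i : Fin P.dom.length) : P.dom.get i ∈ L.sorts :=
  L.dom_preds P hP _ (List.get_mem _ _)

/-- The sorts are not assumed equal, since the code determines the sort too; the sigma type delivers
both facts from one induction. -/
theorem Term.sigma_eq_of_code_eq {s : ℕ} (t : Term L s) : ∀ {s' : ℕ} (t' : Term L s'),
    t.code = t'.code → (⟨s, t⟩ : Σ s, Term L s) = ⟨s', t'⟩ := by
  induction t with
  | var s hs i =>
    intro s' t' h
    cases t' with
    | var s' hs' i' =>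
      simp only [Term.code, Nat.pair_eq_pair, true_and] at h
      obtain ⟨rfl, rfl⟩ := h
      rfl
    | app f hf args => simp [Term.code, Nat.pair_eq_pair] at h
  | app f hf args ih =>
    intro s' t' h
    cases t' with
    | var s' hs' i' => simp [Term.code, Nat.pair_eq_pair] at h
    | app f' hf' args' =>
      simp only [Term.code, Nat.pair_eq_pair, true_and] at h
      obtain ⟨hff, ha⟩ := h
      obtain rfl := FunSym.code_injective hff
      have h2 := List.ofFn_injective (Encodable.encode_injective ha)
      have : args = args' := by
        funext i
        have := ih i (args' i) (congrFun h2 i)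
        simpa using this
      rw [this]

theorem Term.code_injective {s : ℕ} : Function.Injective (Term.code : Term L s → ℕ) := by
  intro t t' h
  simpa using t.sigma_eq_of_code_eq t' h

theorem Term.sort_eq_of_code_eq {s s' : ℕ} {t : Term L s} {t' : Term L s'}
    (h : t.code = t'.code) : s = s' :=
  congrArg Sigma.fst (t.sigma_eq_of_code_eq t' h)

theorem Formula.code_injective : Function.Injective (Formula.code : Formula L → ℕ) := by
  intro φ
  induction φ with
  | eq s hs t t' =>
    intro ψ h
    cases ψ <;> simp only [Formula.code, Nat.pair_eq_pair, true_and] at h <;> try omega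
    obtain ⟨rfl, h1, h2⟩ := h
    rw [Term.code_injective h1, Term.code_injective h2]
  | rel P hP args =>
    intro ψ h
    cases ψ <;> simp only [Formula.code, Nat.pair_eq_pair, true_and] at h <;> try omega
    obtain ⟨hff, ha⟩ := h
    obtain rfl := PredSym.code_injective hff
    have h2 := List.ofFn_injective (Encodable.encode_injective ha)
    congr 1
    funext i
    exact Term.code_injective (congrFun h2 i)
  | neg φ ih =>
    intro ψ h
    cases ψ <;> simp only [Formula.code, Nat.pair_eq_pair, true_and] at h <;> try omega
    rw [ih h]
  | and φ φ' ih ih' =>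
    intro ψ h
    cases ψ <;> simp only [Formula.code, Nat.pair_eq_pair, true_and] at h <;> try omega
    rw [ih h.1, ih' h.2]
  | all s hs i φ ih =>
    intro ψ h
    cases ψ <;> simp only [Formula.code, Nat.pair_eq_pair, true_and] at h <;> try omega
    obtain ⟨⟨rfl, rfl⟩, h2⟩ := h
    rw [ih h2]

instance : Countable (Formula L) := Formula.code_injective.countable

/-- Codes do not mention the signature, so one list of numbers can be read over L₁, over L₂ and over
their union. -/
theorem Term.code_incl (h : L.Sub L') {s : ℕ} (t : Term L s) : (t.incl h).code = t.code := by
  induction t with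
  | var s hs i => rfl
  | app f hf args ih => simp only [Term.incl, Term.code, ih]

theorem Formula.code_incl (h : L.Sub L') (φ : Formula L) : (φ.incl h).code = φ.code := by
  induction φ with
  | eq s hs t t' => simp only [Formula.incl, Formula.code, Term.code_incl]
  | rel P hP args => simp only [Formula.incl, Formula.code, Term.code_incl]
  | neg φ ih => simp only [Formula.incl, Formula.code, ih]
  | and φ ψ ih₁ ih₂ => simp only [Formula.incl, Formula.code, ih₁, ih₂]
  | all s hs i φ ih => simp only [Formula.incl, Formula.code, ih]

theorem Formula.isQF_incl (h : L.Sub L') (φ : Formula L) : (φ.incl h).IsQF ↔ φ.IsQF := by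
  induction φ with
  | eq s hs t t' => rfl
  | rel P hP args => rfl
  | neg φ ih => exact ih
  | and φ ψ ih₁ ih₂ => exact and_congr ih₁ ih₂
  | all s hs i φ ih => rfl

/-! ## Bounds on codes -/

theorem le_pair_of_le_right {a b c : ℕ} (h : a ≤ c) : a ≤ Nat.pair b c :=
  h.trans (Nat.right_le_pair b c)

theorem le_pair_of_le_left {a b c : ℕ} (h : a ≤ b) : a ≤ Nat.pair b c :=
  h.trans (Nat.left_le_pair b c)

/-- The positive tag makes the inequality strict, as `Nat.pair 0 0 = 0`; this is why compound
expressions with nonzero tags allow recursion on codes. -/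
theorem lt_pair_of_le_right {a b c : ℕ} (hb : 0 < b) (h : a ≤ c) : a < Nat.pair b c := by
  have h1 := Nat.add_le_pair b c
  omega

theorem le_encode_of_mem {l : List ℕ} {a : ℕ} (h : a ∈ l) : a ≤ Encodable.encode l := by
  induction l with
  | nil => simp at h
  | cons b l ih =>
    rw [Encodable.encode_list_cons]
    rcases List.mem_cons.1 h with rfl | h
    · exact (le_pair_of_le_left le_rfl).trans (Nat.le_succ _)
    · exact (le_pair_of_le_right (ih h)).trans (Nat.le_succ _)

theorem le_encode_ofFn {n : ℕ} (g : Fin n → ℕ) (i : Fin n) :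
    g i ≤ Encodable.encode (List.ofFn g) :=
  le_encode_of_mem (List.mem_ofFn.2 ⟨i, rfl⟩)

theorem Term.code_arg_lt (f : FunSym) (hf : f ∈ L.funs)
    (args : (i : Fin f.dom.length) → Term L (f.dom.get i)) (i : Fin f.dom.length) :
    (args i).code < (Term.app f hf args).code :=
  lt_pair_of_le_right one_pos <| le_pair_of_le_right <|
    le_encode_ofFn (fun i => (args i).code) i

theorem Formula.code_rel_arg_lt (P : PredSym) (hP : P ∈ L.preds)
    (args : (i : Fin P.dom.length) → Term L (P.dom.get i)) (i : Fin P.dom.length) :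
    (args i).code < (Formula.rel P hP args).code :=
  lt_pair_of_le_right one_pos <| le_pair_of_le_right <|
    le_encode_ofFn (fun i => (args i).code) i

theorem Term.le_code_of_mem_vars {s : ℕ} (t : Term L s) {v : ℕ × ℕ} (h : v ∈ t.vars) :
    v.2 ≤ t.code := by
  induction t with
  | var s hs i =>
    obtain rfl : v = (s, i) := h
    exact le_pair_of_le_right (le_pair_of_le_right le_rfl)
  | app f hf args ih =>
    obtain ⟨i, hi⟩ := Set.mem_iUnion.1 h
    exact (ih i hi).trans (Term.code_arg_lt f hf args i).le

/-- Supplies fresh variables: every index above the code of a formula is free for other use. -/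
theorem Formula.le_code_of_mem_freeVars (φ : Formula L) {v : ℕ × ℕ} (h : v ∈ φ.freeVars) :
    v.2 ≤ φ.code := by
  induction φ with
  | eq s hs t t' =>
    rcases h with h | h
    · exact le_pair_of_le_right (le_pair_of_le_right
        (le_pair_of_le_left (t.le_code_of_mem_vars h)))
    · exact le_pair_of_le_right (le_pair_of_le_right
        (le_pair_of_le_right (t'.le_code_of_mem_vars h)))
  | rel P hP args =>
    obtain ⟨i, hi⟩ := Set.mem_iUnion.1 h
    exact ((args i).le_code_of_mem_vars hi).trans (Formula.code_rel_arg_lt P hP args i).le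
  | neg φ ih => exact le_pair_of_le_right (ih h)
  | and φ ψ ih₁ ih₂ =>
    rcases h with h | h
    · exact le_pair_of_le_right (le_pair_of_le_left (ih₁ h))
    · exact le_pair_of_le_right (le_pair_of_le_right (ih₂ h))
  | all s hs i φ ih => exact le_pair_of_le_right (le_pair_of_le_right (ih h.1))

/-! ## Truth depends on the free variables only -/

theorem Term.eval_congr {A : Structure.{u} L} {ν μ : Assignment A} {s : ℕ} (t : Term L s)
    (h : ∀ s hs i, (s, i) ∈ t.vars → ν s hs i = μ s hs i) : t.eval A ν = t.eval A μ := by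
  induction t with
  | var s hs i => exact h s hs i rfl
  | app f hf args ih =>
    simp only [Term.eval]
    congr 1
    funext i
    exact ih i fun s hs j hj => h s hs j (Set.mem_iUnion.2 ⟨i, hj⟩)

theorem Formula.realize_congr {A : Structure.{u} L} (φ : Formula L) : ∀ {ν μ : Assignment A},
    (∀ s hs i, (s, i) ∈ φ.freeVars → ν s hs i = μ s hs i) →
      (φ.Realize A ν ↔ φ.Realize A μ) := by
  induction φ with
  | eq s hs t t' =>
    intro ν μ h
    simp only [Formula.Realize]
    rw [t.eval_congr fun s hs i hi => h s hs i (Or.inl hi),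
      t'.eval_congr fun s hs i hi => h s hs i (Or.inr hi)]
  | rel P hP args =>
    intro ν μ h
    simp only [Formula.Realize]
    rw [show (fun i => (args i).eval A ν) = fun i => (args i).eval A μ from
      funext fun i => (args i).eval_congr fun s hs j hj => h s hs j (Set.mem_iUnion.2 ⟨i, hj⟩)]
  | neg φ ih =>
    intro ν μ h
    exact not_congr (ih h)
  | and φ ψ ih₁ ih₂ =>
    intro ν μ h
    exact and_congr (ih₁ fun s hs i hi => h s hs i (Or.inl hi))
      (ih₂ fun s hs i hi => h s hs i (Or.inr hi))
  | all s hs i φ ih =>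
    intro ν μ h
    refine forall_congr' fun a => ih fun s' hs' j hj => ?_
    simp only [Assignment.update]
    split_ifs with hc
    · rfl
    · exact h s' hs' j ⟨hj, fun he => hc (by simp_all)⟩

theorem Sentence.realize_iff {A : Structure.{u} L} (φ : Sentence L) (ν μ : Assignment A) :
    φ.1.Realize A ν ↔ φ.1.Realize A μ :=
  φ.1.realize_congr fun s hs i hi => by simp [φ.2] at hi

/-- Whether an interpretation is a `T`-interpretation does not depend on the assignment. -/
theorem Interpretation.models_congr_asg {T : Theory L} {A : Structure.{u} L}
    (ν μ : Assignment A) : (⟨A, ν⟩ : Interpretation L).Models T →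
      (⟨A, μ⟩ : Interpretation L).Models T :=
  fun h ψ hψ => (Sentence.realize_iff ψ ν μ).1 (h ψ hψ)

/-! ## Reducts -/

/-- The reduct of a structure to a smaller signature. -/
def Structure.reduct (h : L.Sub L') (A : Structure.{u} L') : Structure.{u} L where
  carrier := A.carrier
  carrier_nonempty := fun s hs => A.carrier_nonempty s (h.sorts hs)
  fn := fun f hf => A.fn f (h.funs hf)
  pred := fun P hP => A.pred P (h.preds hP)

/-- The restriction of an assignment to the sorts of a smaller signature. -/
def Assignment.reduct (h : L.Sub L') {A : Structure.{u} L'} (ν : Assignment A) :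
    Assignment (A.reduct h) :=
  fun s hs i => ν s (h.sorts hs) i

theorem Term.eval_incl (h : L.Sub L') (A : Structure.{u} L') (ν : Assignment A) {s : ℕ}
    (t : Term L s) : (t.incl h).eval A ν = t.eval (A.reduct h) (ν.reduct h) := by
  induction t with
  | var s hs i => rfl
  | app f hf args ih =>
    simp only [Term.incl, Term.eval, ih]
    rfl

theorem Formula.realize_incl (h : L.Sub L') (A : Structure.{u} L') (φ : Formula L) :
    ∀ ν : Assignment A, (φ.incl h).Realize A ν ↔ φ.Realize (A.reduct h) (ν.reduct h) := by
  induction φ with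
  | eq s hs t t' => intro ν; simp only [Formula.incl, Formula.Realize, Term.eval_incl]; rfl
  | rel P hP args => intro ν; simp only [Formula.incl, Formula.Realize, Term.eval_incl]; rfl
  | neg φ ih => exact fun ν => not_congr (ih ν)
  | and φ ψ ih₁ ih₂ => exact fun ν => and_congr (ih₁ ν) (ih₂ ν)
  | all s hs i φ ih => exact fun ν => forall_congr' fun a => ih (ν.update s i a)

theorem Theory.models_union_iff {T₁ : Theory L₁} {T₂ : Theory L₂}
    (A : Structure.{u} (L₁.union L₂)) (ν : Assignment A) :
    (⟨A, ν⟩ : Interpretation _).Models (T₁.union T₂) ↔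
      (⟨A.reduct (L₁.sub_union_left L₂), ν.reduct _⟩ : Interpretation _).Models T₁ ∧
      (⟨A.reduct (L₁.sub_union_right L₂), ν.reduct _⟩ : Interpretation _).Models T₂ := by
  constructor
  · intro h
    exact ⟨fun ψ hψ => (Formula.realize_incl _ A ψ.1 ν).1 (h _ (Or.inl ⟨ψ, hψ, rfl⟩)),
      fun ψ hψ => (Formula.realize_incl _ A ψ.1 ν).1 (h _ (Or.inr ⟨ψ, hψ, rfl⟩))⟩
  · rintro ⟨h₁, h₂⟩ _ (⟨ψ, hψ, rfl⟩ | ⟨ψ, hψ, rfl⟩)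
    · exact (Formula.realize_incl _ A ψ.1 ν).2 (h₁ ψ hψ)
    · exact (Formula.realize_incl _ A ψ.1 ν).2 (h₂ ψ hψ)

/-! ## Transport along bijections of the domains -/

/-- The structure obtained from `A` by transport along bijections of the domains. -/
def Structure.transport (A : Structure.{u} L) {C : ℕ → Type u}
    (e : ∀ s ∈ L.sorts, A.carrier s ≃ C s) : Structure.{u} L where
  carrier := C
  carrier_nonempty := fun s hs => (A.carrier_nonempty s hs).map (e s hs)
  fn := fun f hf args => e f.cod (L.cod_funs f hf)
    (A.fn f hf fun i => (e _ (L.get_dom_fun_mem hf i)).symm (args i))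
  pred := fun P hP args => A.pred P hP fun i => (e _ (L.get_dom_pred_mem hP i)).symm (args i)

/-- Transport of an assignment along bijections of the domains. -/
def Assignment.transport {A : Structure.{u} L} (ν : Assignment A) {C : ℕ → Type u}
    (e : ∀ s ∈ L.sorts, A.carrier s ≃ C s) : Assignment (A.transport e) :=
  fun s hs i => e s hs (ν s hs i)

theorem Structure.transport_fn (A : Structure.{u} L) {C : ℕ → Type u}
    (e : ∀ s ∈ L.sorts, A.carrier s ≃ C s) (f : FunSym) (hf : f ∈ L.funs)
    (args : (i : Fin f.dom.length) → A.carrier (f.dom.get i)) :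
    (A.transport e).fn f hf (fun i => e _ (L.get_dom_fun_mem hf i) (args i)) =
      e f.cod (L.cod_funs f hf) (A.fn f hf args) := by
  simp only [Structure.transport, Equiv.symm_apply_apply]

theorem Structure.transport_pred (A : Structure.{u} L) {C : ℕ → Type u}
    (e : ∀ s ∈ L.sorts, A.carrier s ≃ C s) (P : PredSym) (hP : P ∈ L.preds)
    (args : (i : Fin P.dom.length) → A.carrier (P.dom.get i)) :
    (A.transport e).pred P hP (fun i => e _ (L.get_dom_pred_mem hP i) (args i)) ↔
      A.pred P hP args := by
  simp only [Structure.transport, Equiv.symm_apply_apply]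

theorem Term.eval_transport (A : Structure.{u} L) (ν : Assignment A) {C : ℕ → Type u}
    (e : ∀ s ∈ L.sorts, A.carrier s ≃ C s) {s : ℕ} (t : Term L s) (hs : s ∈ L.sorts) :
    t.eval (A.transport e) (ν.transport e) = e s hs (t.eval A ν) := by
  induction t with
  | var s hs i => rfl
  | app f hf args ih =>
    rw [Term.eval, Term.eval, ← A.transport_fn e]
    congr 1
    funext i
    exact ih i _

theorem Assignment.transport_update {A : Structure.{u} L} (ν : Assignment A) {C : ℕ → Type u}
    (e : ∀ s ∈ L.sorts, A.carrier s ≃ C s) (s : ℕ) (hs : s ∈ L.sorts) (i : ℕ)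
    (a : A.carrier s) :
    (ν.update s i a).transport e = (ν.transport e).update s i (e s hs a) := by
  funext s' hs' j
  by_cases h : s = s' ∧ j = i
  · obtain ⟨rfl, rfl⟩ := h
    simp [Assignment.transport, Assignment.update]
    rfl
  · simp [Assignment.transport, Assignment.update, h]
    rfl

theorem Formula.realize_transport (A : Structure.{u} L) {C : ℕ → Type u}
    (e : ∀ s ∈ L.sorts, A.carrier s ≃ C s) (φ : Formula L) : ∀ ν : Assignment A,
    φ.Realize (A.transport e) (ν.transport e) ↔ φ.Realize A ν := by
  induction φ with
  | eq s hs t t' =>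
    intro ν
    simp only [Formula.Realize, Term.eval_transport _ _ _ _ hs]
    exact (e s hs).apply_eq_iff_eq
  | rel P hP args =>
    intro ν
    rw [Formula.Realize, Formula.Realize, ← A.transport_pred e]
    rw [show (fun i => (args i).eval (A.transport e) (ν.transport e)) = _ from
      funext fun i => (args i).eval_transport A ν e (L.get_dom_pred_mem hP i)]
  | neg φ ih => exact fun ν => not_congr (ih ν)
  | and φ ψ ih₁ ih₂ => exact fun ν => and_congr (ih₁ ν) (ih₂ ν)
  | all s hs i φ ih =>
    intro ν
    refine ((e s hs).forall_congr fun {a} => ?_).symm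
    rw [← ih, Assignment.transport_update _ _ _ hs]

/-! ## Ultraproducts -/

section Ultraproduct

open Filter

variable (U : Ultrafilter ℕ)

/-- The ultraproduct of a sequence of structures. -/
noncomputable def Structure.ultraproduct (A : ℕ → Structure.{u} L) : Structure.{u} L where
  carrier := fun s => Quotient (productSetoid (U : Filter ℕ) fun k => (A k).carrier s)
  carrier_nonempty := fun s hs =>
    ⟨Quotient.mk _ fun k => ((A k).carrier_nonempty s hs).some⟩
  fn := fun f hf args => Quotient.mk _ fun k => (A k).fn f hf fun i => (args i).out k
  pred := fun P hP args => ∀ᶠ k in (U : Filter ℕ), (A k).pred P hP fun i => (args i).out k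

variable {U} {A : ℕ → Structure.{u} L}

/-- The element of the ultraproduct given by a sequence of elements. -/
def Structure.ultraproductMk (U : Ultrafilter ℕ) {A : ℕ → Structure.{u} L} {s : ℕ}
    (g : ∀ k, (A k).carrier s) : (Structure.ultraproduct U A).carrier s :=
  Quotient.mk _ g

/-- The assignment into the ultraproduct given by a sequence of assignments. -/
def Assignment.ultraproduct (U : Ultrafilter ℕ) (ν : ∀ k, Assignment (A k)) :
    Assignment (Structure.ultraproduct U A) :=
  fun s hs i => Structure.ultraproductMk U fun k => ν k s hs i

theorem Structure.ultraproductMk_eq_iff {s : ℕ} {g g' : ∀ k, (A k).carrier s} :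
    ultraproductMk U g = ultraproductMk U g' ↔ ∀ᶠ k in (U : Filter ℕ), g k = g' k :=
  Quotient.eq

theorem Structure.ultraproductMk_surjective {s : ℕ}
    (a : (Structure.ultraproduct U A).carrier s) :
    ∃ g : ∀ k, (A k).carrier s, ultraproductMk U g = a :=
  Quotient.exists_rep a

/-- Makes the choice of representatives by `Quotient.out` harmless: finitely many arguments give
finitely many large sets, whose intersection is large. -/
theorem Structure.eventually_out {n : ℕ} {s : Fin n → ℕ}
    (g : (i : Fin n) → ∀ k, (A k).carrier (s i)) :
    ∀ᶠ k in (U : Filter ℕ), (fun i => Quotient.out (ultraproductMk U (g i)) k) =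
      fun i => g i k := by
  have : ∀ i, ∀ᶠ k in (U : Filter ℕ), Quotient.out (ultraproductMk U (g i)) k = g i k :=
    fun i => Quotient.mk_out (s := productSetoid _ _) (g i)
  filter_upwards [eventually_all.2 this] with k hk
  funext i
  exact hk i

theorem Term.eval_ultraproduct (ν : ∀ k, Assignment (A k)) {s : ℕ} (t : Term L s) :
    t.eval (Structure.ultraproduct U A) (Assignment.ultraproduct U ν) =
      Structure.ultraproductMk U fun k => t.eval (A k) (ν k) := by
  induction t with
  | var s hs i => rfl
  | app f hf args ih =>
    simp only [Term.eval, ih]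
    refine Structure.ultraproductMk_eq_iff.2 ?_
    filter_upwards [Structure.eventually_out (U := U)
      fun i k => (args i).eval (A k) (ν k)] with k hk
    exact congrArg _ hk

theorem Assignment.ultraproduct_update (ν : ∀ k, Assignment (A k)) (s i : ℕ)
    (g : ∀ k, (A k).carrier s) :
    Assignment.ultraproduct U (fun k => (ν k).update s i (g k)) =
      (Assignment.ultraproduct U ν).update s i (Structure.ultraproductMk U g) := by
  funext s' hs' j
  by_cases h : s = s' ∧ j = i
  · obtain ⟨rfl, rfl⟩ := h
    simp [Assignment.ultraproduct, Assignment.update]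
  · simp [Assignment.ultraproduct, Assignment.update, h]

/-- Łoś's theorem. -/
theorem Formula.realize_ultraproduct (φ : Formula L) : ∀ ν : ∀ k, Assignment (A k),
    φ.Realize (Structure.ultraproduct U A) (Assignment.ultraproduct U ν) ↔
      ∀ᶠ k in (U : Filter ℕ), φ.Realize (A k) (ν k) := by
  induction φ with
  | eq s hs t t' =>
    intro ν
    simp only [Formula.Realize, Term.eval_ultraproduct]
    exact Structure.ultraproductMk_eq_iff
  | rel P hP args =>
    intro ν
    simp only [Formula.Realize, Term.eval_ultraproduct]
    refine eventually_congr ?_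
    filter_upwards [Structure.eventually_out (U := U)
      fun i k => (args i).eval (A k) (ν k)] with k hk
    exact iff_of_eq (congrArg _ hk)
  | neg φ ih =>
    intro ν
    simp only [Formula.Realize, ih]
    exact Ultrafilter.eventually_not.symm
  | and φ ψ ih₁ ih₂ =>
    intro ν
    simp only [Formula.Realize, ih₁, ih₂, eventually_and]
  | all s hs i φ ih =>
    intro ν
    simp only [Formula.Realize]
    constructor
    · intro h
      by_contra hn
      rw [← Ultrafilter.eventually_not] at hn
      -- A counterexample in each factor that has one and an arbitrary element elsewhere; together
      -- they form an element of the ultraproduct that refutes `h`.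
      have : ∀ k, ∃ a : (A k).carrier s, (¬ ∀ a, φ.Realize (A k) ((ν k).update s i a)) →
          ¬ φ.Realize (A k) ((ν k).update s i a) := by
        intro k
        by_cases hk : ∀ a, φ.Realize (A k) ((ν k).update s i a)
        · exact ⟨((A k).carrier_nonempty s hs).some, fun h => absurd hk h⟩
        · obtain ⟨a, ha⟩ := not_forall.1 hk
          exact ⟨a, fun _ => ha⟩
      choose g hg using this
      have h1 := h (Structure.ultraproductMk U g)
      rw [← Assignment.ultraproduct_update, ih] at h1
      obtain ⟨k, hk1, hk2⟩ := (h1.and hn).exists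
      exact hg k hk2 hk1
    · intro h a
      obtain ⟨g, rfl⟩ := Structure.ultraproductMk_surjective a
      rw [← Assignment.ultraproduct_update, ih]
      filter_upwards [h] with k hk
      exact hk (g k)

/-- After identifying every factor with `Fin n`, a sequence partitions ℕ into n pieces, one of which
belongs to the ultrafilter; hence it equals a constant sequence. -/
theorem Structure.mk_ultraproduct_of_finite {s : ℕ} {c : Cardinal.{u}} (hc : c < Cardinal.aleph0)
    (h : ∀ k, Cardinal.mk ((A k).carrier s) = c) :
    Cardinal.mk ((Structure.ultraproduct U A).carrier s) = c := by
  obtain ⟨n, rfl⟩ := Cardinal.lt_aleph0.1 hc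
  have e : ∀ k, Nonempty ((A k).carrier s ≃ Fin n) := fun k => by
    rw [← Cardinal.lift_mk_eq', h k]
    simp
  replace e := fun k => (e k).some
  let F : Fin n → (Structure.ultraproduct U A).carrier s :=
    fun j => ultraproductMk U fun k => (e k).symm j
  have hF : Function.Bijective F := by
    constructor
    · intro j j' hj
      obtain ⟨k, hk⟩ := (ultraproductMk_eq_iff.1 hj).exists
      exact (e k).symm.injective hk
    · intro a
      obtain ⟨g, rfl⟩ := ultraproductMk_surjective a
      have : (⋃ j ∈ (Set.univ : Set (Fin n)), {k | e k (g k) = j}) ∈ U := by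
        have hu : (⋃ j ∈ (Set.univ : Set (Fin n)), {k | e k (g k) = j}) = Set.univ := by
          ext k
          simp
        rw [hu]
        exact Filter.univ_mem
      obtain ⟨j, -, hj⟩ := (Ultrafilter.finite_biUnion_mem_iff Set.finite_univ).1 this
      refine ⟨j, ultraproductMk_eq_iff.2 ?_⟩
      filter_upwards [hj] with k hk
      rw [Equiv.symm_apply_eq]
      exact hk.symm
  have := Cardinal.lift_mk_eq'.2 ⟨Equiv.ofBijective F hF⟩
  simpa using this.symm

/-- For each n, all but finitely many factors contain n distinct elements, and n sequences of these
remain distinct because the ultrafilter contains the cofinite sets. -/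
theorem Structure.aleph0_le_mk_ultraproduct {s : ℕ} (hs : s ∈ L.sorts)
    (hU : (U : Filter ℕ) ≤ Filter.cofinite)
    (h : ∀ k : ℕ, (k : Cardinal.{u}) ≤ Cardinal.mk ((A k).carrier s)) :
    Cardinal.aleph0 ≤ Cardinal.mk ((Structure.ultraproduct U A).carrier s) := by
  rw [Cardinal.aleph0_le]
  intro n
  have : ∀ k, ∃ F : Fin n → (A k).carrier s, n ≤ k → Function.Injective F := by
    intro k
    by_cases hk : n ≤ k
    · have h1 : (n : Cardinal.{u}) ≤ Cardinal.mk ((A k).carrier s) :=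
        (Nat.cast_le.2 hk).trans (h k)
      have h2 : Cardinal.lift.{u} (Cardinal.mk (Fin n)) ≤
          Cardinal.lift.{0} (Cardinal.mk ((A k).carrier s)) := by simpa using h1
      obtain ⟨F⟩ := Cardinal.lift_mk_le'.1 h2
      exact ⟨F, fun _ => F.injective⟩
    · exact ⟨fun _ => ((A k).carrier_nonempty s hs).some, fun h => absurd h hk⟩
  choose F hF using this
  have hinj : Function.Injective fun j : Fin n => ultraproductMk U fun k => F k j := by
    intro j j' hj
    have hlarge : ∀ᶠ k in (U : Filter ℕ), n ≤ k := by
      refine hU ?_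
      rw [Nat.cofinite_eq_atTop]
      exact eventually_ge_atTop n
    obtain ⟨k, hk, hk'⟩ := ((ultraproductMk_eq_iff.1 hj).and hlarge).exists
    exact hF k hk' hk
  have := Cardinal.lift_mk_le'.2 ⟨⟨_, hinj⟩⟩
  simpa using this

end Ultraproduct

/-! ## The downward Löwenheim–Skolem theorem -/

section LowenheimSkolem

variable {A : Structure.{u} L}

/-- Change the values of an assignment at all variables of index less than `N`. -/
def Assignment.patch (ν : Assignment A) {N : ℕ} (p : (s : L.sorts) → Fin N → A.carrier s) :
    Assignment A :=
  fun s hs i => if h : i < N then p ⟨s, hs⟩ ⟨i, h⟩ else ν s hs i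

open Classical in
/-- An element witnessing `∃ x, φ` if there is one. -/
noncomputable def Formula.witness (φ : Formula L) (s : ℕ) (hs : s ∈ L.sorts) (i : ℕ)
    (ν : Assignment A) : A.carrier s :=
  if h : ∃ a, φ.Realize A (ν.update s i a) then h.choose else (A.carrier_nonempty s hs).some

/-- Close a family of subsets once under the functions and the witnesses of formulas. -/
def Structure.skolemStep (ν : Assignment A) (X : ∀ s, Set (A.carrier s)) (s : ℕ) :
    Set (A.carrier s) :=
  X s ∪ (⋃ (f : FunSym) (hf : f ∈ L.funs) (h : f.cod = s),
      Set.range fun args : (i : Fin f.dom.length) → X (f.dom.get i) =>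
        (h ▸ A.fn f hf fun i => args i : A.carrier s)) ∪
    -- Only the variables of index below N vary, over finitely many sorts, and all others keep their
    -- values under `ν`; thus there are countably many parameters `p` when the sets `X s` are
    -- countable.
    ⋃ (hs : s ∈ L.sorts) (φ : Formula L) (i : ℕ) (N : ℕ),
      Set.range fun p : (s : L.sorts) → Fin N → X s =>
        φ.witness s hs i (ν.patch fun s j => (p s j : A.carrier s))

theorem Structure.countable_skolemStep (ν : Assignment A) {X : ∀ s, Set (A.carrier s)}
    (hX : ∀ s, (X s).Countable) (s : ℕ) : (Structure.skolemStep ν X s).Countable := by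
  have : ∀ s, Countable (X s) := fun s => (hX s).to_subtype
  refine ((hX s).union ?_).union ?_
  · exact Set.countable_iUnion fun f => Set.countable_iUnion fun hf =>
      Set.countable_iUnion fun h => Set.countable_range _
  · exact Set.countable_iUnion fun hs => Set.countable_iUnion fun φ =>
      Set.countable_iUnion fun i => Set.countable_iUnion fun N => Set.countable_range _

/-- Iterated closure under the functions and the witnesses of formulas. -/
def Structure.skolemStage (ν : Assignment A) (X : ∀ s, Set (A.carrier s)) :
    ℕ → ∀ s, Set (A.carrier s)
  | 0 => X
  | n + 1 => Structure.skolemStep ν (skolemStage ν X n)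

theorem Structure.skolemStage_mono (ν : Assignment A) (X : ∀ s, Set (A.carrier s)) (s : ℕ) :
    Monotone fun n => Structure.skolemStage ν X n s :=
  monotone_nat_of_le_succ fun _ _ ha => Or.inl (Or.inl ha)

theorem Structure.countable_skolemStage (ν : Assignment A) {X : ∀ s, Set (A.carrier s)}
    (hX : ∀ s, (X s).Countable) (n : ℕ) :
    ∀ s, (Structure.skolemStage ν X n s).Countable := by
  induction n with
  | zero => exact hX
  | succ n ih => exact Structure.countable_skolemStep ν ih

/-- The stages increase, so finitely many elements of the union already lie in one stage; this makes
the union closed under functions and witnesses. -/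
theorem Structure.exists_skolemStage (ν : Assignment A) (X : ∀ s, Set (A.carrier s))
    {ι : Type*} [Finite ι] {s : ι → ℕ} (x : (i : ι) → A.carrier (s i))
    (hx : ∀ i, x i ∈ ⋃ n, Structure.skolemStage ν X n (s i)) :
    ∃ n, ∀ i, x i ∈ Structure.skolemStage ν X n (s i) := by
  choose n hn using fun i => Set.mem_iUnion.1 (hx i)
  obtain ⟨m, hm⟩ := Finite.exists_le n
  exact ⟨m, fun i => Structure.skolemStage_mono ν X (s i) (hm i) (hn i)⟩

/-- The substructure on a family of subsets closed under the functions. -/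
def Structure.restrict (A : Structure.{u} L) (X : ∀ s, Set (A.carrier s))
    (hne : ∀ s ∈ L.sorts, (X s).Nonempty)
    (hfn : ∀ (f : FunSym) (hf : f ∈ L.funs) (args : (i : Fin f.dom.length) → X (f.dom.get i)),
      A.fn f hf (fun i => args i) ∈ X f.cod) : Structure.{u} L where
  carrier := fun s => X s
  carrier_nonempty := fun s hs => (hne s hs).to_subtype
  fn := fun f hf args => ⟨_, hfn f hf args⟩
  pred := fun P hP args => A.pred P hP fun i => (args i : A.carrier _)

section Restrict

variable {X : ∀ s, Set (A.carrier s)} {hne : ∀ s ∈ L.sorts, (X s).Nonempty}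
  {hfn : ∀ (f : FunSym) (hf : f ∈ L.funs) (args : (i : Fin f.dom.length) → X (f.dom.get i)),
      A.fn f hf (fun i => args i) ∈ X f.cod}

/-- An assignment into a substructure, read as an assignment into the structure. -/
def Assignment.val (ν : Assignment (A.restrict X hne hfn)) : Assignment A :=
  fun s hs i => (ν s hs i).1

theorem Term.eval_restrict (ν : Assignment (A.restrict X hne hfn)) {s : ℕ} (t : Term L s) :
    (t.eval (A.restrict X hne hfn) ν).1 = t.eval A ν.val := by
  induction t with
  | var s hs i => rfl
  | app f hf args ih =>
    simp only [Term.eval, ← ih]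
    rfl

theorem Assignment.val_update (ν : Assignment (A.restrict X hne hfn)) (s i : ℕ) (a : X s) :
    Assignment.val (ν.update s i a) = ν.val.update s i a.1 := by
  funext s' hs' j
  by_cases h : s = s' ∧ j = i
  · obtain ⟨rfl, rfl⟩ := h
    simp [Assignment.val, Assignment.update]
  · simp [Assignment.val, Assignment.update, h]

/-- The Tarski–Vaught criterion. -/
theorem Formula.realize_restrict
    (hX : ∀ (φ : Formula L) (s : ℕ) (_ : s ∈ L.sorts) (i : ℕ) (ν : Assignment A),
      (∀ s hs i, ν s hs i ∈ X s) → (∃ a, φ.Realize A (ν.update s i a)) →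
        ∃ a ∈ X s, φ.Realize A (ν.update s i a)) (φ : Formula L) :
    ∀ ν : Assignment (A.restrict X hne hfn),
      φ.Realize (A.restrict X hne hfn) ν ↔ φ.Realize A ν.val := by
  induction φ with
  | eq s hs t t' =>
    intro ν
    simp only [Formula.Realize, ← Term.eval_restrict]
    exact Subtype.ext_iff
  | rel P hP args =>
    intro ν
    simp only [Formula.Realize, ← Term.eval_restrict]
    rfl
  | neg φ ih => exact fun ν => not_congr (ih ν)
  | and φ ψ ih₁ ih₂ => exact fun ν => and_congr (ih₁ ν) (ih₂ ν)
  | all s hs i φ ih =>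
    intro ν
    simp only [Formula.Realize, ih]
    constructor
    · intro h
      by_contra hn
      obtain ⟨a, ha⟩ := not_forall.1 hn
      -- A counterexample to φ is a witness of its negation, so one can be found inside the
      -- substructure.
      obtain ⟨b, hb, hb'⟩ := hX φ.neg s hs i ν.val (fun s hs i => (ν s hs i).2) ⟨a, ha⟩
      refine hb' ?_
      have := h ⟨b, hb⟩
      rwa [Assignment.val_update] at this
    · intro h (a : X s)
      rw [Assignment.val_update]
      exact h a.1

end Restrict

/-- The downward Löwenheim–Skolem theorem for countable signatures: every interpretation has an
elementary substructure with countable domains, which are infinite where the original ones are and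
equal to them where those are finite. -/
theorem Interpretation.exists_countable (I : Interpretation.{u} L) :
    ∃ J : Interpretation.{u} L, (∀ φ, J.Satisfies φ ↔ I.Satisfies φ) ∧
      ∀ s ∈ L.sorts, J.card s = min (I.card s) Cardinal.aleph0 := by
  obtain ⟨A, ν⟩ := I
  -- `D s` is a seed of the desired cardinality; it prevents the hull from becoming finite, or too
  -- small, in a large sort.
  choose D hD using fun s => Cardinal.le_mk_iff_exists_set.1
    (min_le_left (Cardinal.mk (A.carrier s)) Cardinal.aleph0)
  let X₀ : ∀ s, Set (A.carrier s) := fun s => D s ∪ ⋃ hs : s ∈ L.sorts, Set.range (ν s hs)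
  have hX₀ : ∀ s, (X₀ s).Countable := fun s => by
    refine Set.Countable.union ?_ (Set.countable_iUnion fun _ => Set.countable_range _)
    rw [← Set.countable_coe_iff, ← Cardinal.mk_le_aleph0_iff, hD]
    exact min_le_right _ _
  let X : ∀ s, Set (A.carrier s) := fun s => ⋃ n, Structure.skolemStage ν X₀ n s
  have hX₀X : ∀ s, X₀ s ⊆ X s := fun s => Set.subset_iUnion
    (fun n => Structure.skolemStage ν X₀ n s) 0
  have hν : ∀ s hs i, ν s hs i ∈ X s := fun s hs i =>
    hX₀X s (Or.inr (Set.mem_iUnion.2 ⟨hs, i, rfl⟩))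
  have hfn : ∀ (f : FunSym) (hf : f ∈ L.funs)
      (args : (i : Fin f.dom.length) → X (f.dom.get i)),
      A.fn f hf (fun i => args i) ∈ X f.cod := by
    intro f hf args
    obtain ⟨n, hn⟩ := Structure.exists_skolemStage ν X₀
      (fun i => (args i : A.carrier (f.dom.get i))) (fun i => (args i).2)
    refine Set.mem_iUnion.2 ⟨n + 1, Or.inl (Or.inr ?_)⟩
    simp only [Set.mem_iUnion]
    exact ⟨f, hf, rfl, fun i => ⟨_, hn i⟩, rfl⟩
  have hTV : ∀ (φ : Formula L) (s : ℕ) (_ : s ∈ L.sorts) (i : ℕ) (μ : Assignment A),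
      (∀ s hs i, μ s hs i ∈ X s) → (∃ a, φ.Realize A (μ.update s i a)) →
        ∃ a ∈ X s, φ.Realize A (μ.update s i a) := by
    intro φ s hs i μ hμ h
    -- All free variables of φ have index at most `φ.code`, so patching `ν` on the indices up to
    -- that bound reproduces `μ` as far as φ can see.
    let p : (s : L.sorts) → Fin (φ.code + 1) → A.carrier s := fun s j => μ s s.2 j
    have hp : ∀ a, φ.Realize A (μ.update s i a) ↔
        φ.Realize A ((ν.patch p).update s i a) := by
      intro a
      refine φ.realize_congr fun s' hs' j hj => ?_
      have hj := φ.le_code_of_mem_freeVars hj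
      have hj : j < φ.code + 1 := Nat.lt_succ_of_le hj
      simp [Assignment.update, Assignment.patch, hj, p]
    obtain ⟨n, hn⟩ := Structure.exists_skolemStage ν X₀
      (ι := (_ : L.sorts) × Fin (φ.code + 1)) (s := fun q => q.1) (fun q => p q.1 q.2)
      (fun q => hμ _ _ _)
    simp only [hp] at h ⊢
    refine ⟨φ.witness s hs i (ν.patch p), ?_, ?_⟩
    · refine Set.mem_iUnion.2 ⟨n + 1, Or.inr ?_⟩
      simp only [Set.mem_iUnion]
      exact ⟨hs, φ, i, φ.code + 1, fun s j => ⟨_, hn ⟨s, j⟩⟩, rfl⟩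
    · rw [Formula.witness, dif_pos h]
      exact h.choose_spec
  have hne : ∀ s ∈ L.sorts, (X s).Nonempty := fun s hs => ⟨_, hν s hs 0⟩
  refine ⟨⟨A.restrict X hne hfn, fun s hs i => ⟨_, hν s hs i⟩⟩,
    fun φ => φ.realize_restrict (hne := hne) (hfn := hfn) hTV _, fun s _ => ?_⟩
  change Cardinal.mk (X s) = min (Cardinal.mk (A.carrier s)) _
  refine le_antisymm (le_min (Cardinal.mk_set_le _) ?_) ?_
  · rw [Cardinal.mk_le_aleph0_iff, Set.countable_coe_iff]
    exact Set.countable_iUnion fun n => Structure.countable_skolemStage ν hX₀ n s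
  · rw [← hD]
    exact Cardinal.mk_le_mk_of_subset (Set.subset_union_left.trans (hX₀X s))

end LowenheimSkolem

/-! ## Enlarging the domains of models of a finitely smooth theory -/

/-- Finite smoothness gives models with the exact size in the sorts where `c` is finite and of size
at least k in the others. Their ultraproduct keeps the former sizes and is infinite in the latter
sorts; a countable elementary substructure then has size ℵ₀ there. -/
theorem Theory.FinitelySmooth.exists_card_eq_min {T : Theory L} {S : Finset ℕ}
    (hT : T.FinitelySmooth.{u} S) (hS : S ⊆ L.sorts) {φ : Formula L} (hφ : φ.IsQF)
    {A : Interpretation.{u} L} (hA : A.Models T) (hAφ : A.Satisfies φ)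
    (hfin : ∀ s ∈ S, A.card s < Cardinal.aleph0) {c : ℕ → Cardinal.{u}}
    (hc : ∀ s ∈ S, A.card s ≤ c s) :
    ∃ B : Interpretation.{u} L, B.Models T ∧ B.Satisfies φ ∧
      ∀ s ∈ S, B.card s = min (c s) Cardinal.aleph0 := by
  -- In a sort where `c` is infinite the target grows with k; the maximum keeps it above the size of
  -- `A`, as smoothness requires.
  let κ : ℕ → ℕ → Cardinal.{u} := fun k s =>
    if c s < Cardinal.aleph0 then c s else max (A.card s) k
  have hκ : ∀ k, ∀ s ∈ S, A.card s < Cardinal.aleph0 →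
      A.card s ≤ κ k s ∧ κ k s < Cardinal.aleph0 := by
    intro k s hs hf
    by_cases h : c s < Cardinal.aleph0
    · simp only [κ, h, if_true]
      exact ⟨hc s hs, trivial⟩
    · simp only [κ, h, if_false]
      exact ⟨le_max_left _ _, max_lt hf Cardinal.natCast_lt_aleph0⟩
  choose B hBT hBφ hBc using fun k => hT φ hφ A hA hAφ (κ k) (hκ k)
  let U : Ultrafilter ℕ := Filter.hyperfilter ℕ
  let I : Interpretation.{u} L := ⟨Structure.ultraproduct U fun k => (B k).str,
    Assignment.ultraproduct U fun k => (B k).asg⟩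
  have hI : ∀ ψ : Formula L, (∀ k, (B k).Satisfies ψ) → I.Satisfies ψ := fun ψ h =>
    (ψ.realize_ultraproduct _).2 (Filter.Eventually.of_forall h)
  obtain ⟨J, hJ, hJc⟩ := I.exists_countable
  refine ⟨J, fun ψ hψ => (hJ _).2 (hI _ fun k => hBT k ψ hψ), (hJ _).2 (hI _ hBφ),
    fun s hs => ?_⟩
  rw [hJc s (hS hs)]
  by_cases h : c s < Cardinal.aleph0
  · have : I.card s = c s := Structure.mk_ultraproduct_of_finite h fun k => by
      have := hBc k s hs (hfin s hs)
      simp only [κ, h, if_true] at this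
      exact this
    rw [this]
  · have : Cardinal.aleph0 ≤ I.card s :=
      Structure.aleph0_le_mk_ultraproduct (hS hs) (Filter.hyperfilter_le_cofinite) fun k => by
        have := hBc k s hs (hfin s hs)
        simp only [κ, h, if_false] at this
        exact (le_max_right _ _).trans this.ge
    rw [min_eq_right this, min_eq_right (not_lt.1 h)]

/-! ## Amalgamation of two interpretations -/

/-- The assignment a c ↦ b c is a well-defined injection on a finite set, and such a map extends to
a bijection between equinumerous types. -/
theorem exists_equiv_of_eq_iff_eq {α β : Type u} (hαβ : Cardinal.mk α = Cardinal.mk β) {n : ℕ}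
    {a : ℕ → α} {b : ℕ → β} (h : ∀ c ≤ n, ∀ c' ≤ n, a c = a c' ↔ b c = b c') :
    ∃ e : α ≃ β, ∀ c ≤ n, e (a c) = b c := by
  -- `r` picks an index for each named element; the equivalence `h` makes the resulting map
  -- independent of this choice.
  choose r hr using fun x : a '' Set.Iic n => x.2
  let f : (a '' Set.Iic n) ↪ β := ⟨fun x => b (r x), fun x y hxy => by
    have := (h _ (hr x).1 _ (hr y).1).2 hxy
    rw [(hr x).2, (hr y).2] at this
    exact Subtype.ext this⟩
  have hfin : (a '' Set.Iic n).Finite := (Set.finite_Iic n).image a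
  have : ∃ e : α ≃ β, ∀ x : a '' Set.Iic n, e x = f x := by
    rcases finite_or_infinite α with hα | hα
    · exact Cardinal.extend_function_finite f (Cardinal.eq.1 hαβ)
    · exact Cardinal.extend_function_of_lt f
        ((Cardinal.lt_aleph0_iff_set_finite.2 hfin).trans_le (Cardinal.aleph0_le_mk α))
        (Cardinal.eq.1 hαβ)
  obtain ⟨e, he⟩ := this
  refine ⟨e, fun c hc => ?_⟩
  have hx : a c ∈ a '' Set.Iic n := ⟨c, hc, rfl⟩
  rw [he ⟨_, hx⟩]
  exact (h _ (hr ⟨_, hx⟩).1 _ hc).1 (hr ⟨_, hx⟩).2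

/-- Done sort by sort: a shared sort uses the domain of `B`, reached from `A` by a bijection
matching the named elements, and an unshared sort keeps its own domain. -/
theorem exists_common_carrier (A : Interpretation.{u} L₁) (B : Interpretation.{u} L₂) (n : ℕ)
    (hcard : ∀ s ∈ L₁.sorts, s ∈ L₂.sorts → A.card s = B.card s)
    (heq : ∀ s h₁ h₂, ∀ c ≤ n, ∀ c' ≤ n,
      A.asg s h₁ c = A.asg s h₁ c' ↔ B.asg s h₂ c = B.asg s h₂ c') :
    ∃ (C : ℕ → Type u) (e₁ : ∀ s ∈ L₁.sorts, A.str.carrier s ≃ C s)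
      (e₂ : ∀ s ∈ L₂.sorts, B.str.carrier s ≃ C s),
      ∀ s h₁ h₂, ∀ c ≤ n, e₁ s h₁ (A.asg s h₁ c) = e₂ s h₂ (B.asg s h₂ c) := by
  have : ∀ s, ∃ (C : Type u) (e₁ : s ∈ L₁.sorts → (A.str.carrier s ≃ C))
      (e₂ : s ∈ L₂.sorts → (B.str.carrier s ≃ C)),
      ∀ h₁ h₂, ∀ c ≤ n, e₁ h₁ (A.asg s h₁ c) = e₂ h₂ (B.asg s h₂ c) := by
    intro s
    by_cases h₁ : s ∈ L₁.sorts
    · by_cases h₂ : s ∈ L₂.sorts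
      · obtain ⟨e, he⟩ := exists_equiv_of_eq_iff_eq (hcard s h₁ h₂) (heq s h₁ h₂)
        exact ⟨B.str.carrier s, fun _ => e, fun _ => Equiv.refl _, fun _ _ => he⟩
      · exact ⟨A.str.carrier s, fun _ => Equiv.refl _, fun h => absurd h h₂,
          fun _ h => absurd h h₂⟩
    · exact ⟨B.str.carrier s, fun h => absurd h h₁, fun _ => Equiv.refl _,
        fun h => absurd h h₁⟩
  choose C e₁ e₂ he using this
  exact ⟨C, e₁, e₂, he⟩

open Classical in
/-- The structure for `L₁ ∪ L₂` on common copies of the domains of two structures. -/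
noncomputable def Structure.amalgam (A : Structure.{u} L₁) (B : Structure.{u} L₂)
    {C : ℕ → Type u} (e₁ : ∀ s ∈ L₁.sorts, A.carrier s ≃ C s)
    (e₂ : ∀ s ∈ L₂.sorts, B.carrier s ≃ C s) : Structure.{u} (L₁.union L₂) where
  carrier := C
  carrier_nonempty := fun s hs => (Finset.mem_union.1 hs).elim
    ((A.transport e₁).carrier_nonempty s) ((B.transport e₂).carrier_nonempty s)
  fn := fun f hf => if h : f ∈ L₁.funs then (A.transport e₁).fn f h
    else (B.transport e₂).fn f (hf.resolve_left h)
  pred := fun P hP => if h : P ∈ L₁.preds then (A.transport e₁).pred P h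
    else (B.transport e₂).pred P (hP.resolve_left h)

/-- A reduct of an `amalgam` and a `transport` have the same carrier by definition, so with `C`
fixed only symbols have to be compared and no casts arise. -/
theorem Formula.realize_congr_str {C : ℕ → Type u} {hC : ∀ s ∈ L.sorts, Nonempty (C s)}
    {fn fn' : (f : FunSym) → f ∈ L.funs → ((i : Fin f.dom.length) → C (f.dom.get i)) → C f.cod}
    {pred pred' : (P : PredSym) → P ∈ L.preds →
      ((i : Fin P.dom.length) → C (P.dom.get i)) → Prop}
    (hfn : ∀ f hf, fn f hf = fn' f hf) (hpred : ∀ P hP, pred P hP = pred' P hP)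
    (φ : Formula L) (ν : (s : ℕ) → s ∈ L.sorts → ℕ → C s) :
    φ.Realize ⟨C, hC, fn, pred⟩ ν ↔ φ.Realize ⟨C, hC, fn', pred'⟩ ν := by
  obtain rfl : fn = fn' := funext fun f => funext (hfn f)
  obtain rfl : pred = pred' := funext fun f => funext (hpred f)
  rfl

section Amalgam

variable (A : Structure.{u} L₁) (B : Structure.{u} L₂) {C : ℕ → Type u}
  (e₁ : ∀ s ∈ L₁.sorts, A.carrier s ≃ C s) (e₂ : ∀ s ∈ L₂.sorts, B.carrier s ≃ C s)

theorem Formula.realize_amalgam_left (φ : Formula L₁) (ν : Assignment A) :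
    φ.Realize ((A.amalgam B e₁ e₂).reduct (L₁.sub_union_left L₂)) (ν.transport e₁) ↔
      φ.Realize A ν := by
  rw [← φ.realize_transport A e₁ ν]
  exact Formula.realize_congr_str (fun f hf => dif_pos hf) (fun P hP => dif_pos hP) φ _

theorem Formula.realize_amalgam_right (hdisj : L₁.IsDisjoint L₂) (φ : Formula L₂)
    (ν : Assignment B) :
    φ.Realize ((A.amalgam B e₁ e₂).reduct (L₁.sub_union_right L₂)) (ν.transport e₂) ↔
      φ.Realize B ν := by
  rw [← φ.realize_transport B e₂ ν]
  exact Formula.realize_congr_str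
    (fun f hf => dif_neg fun h => Set.disjoint_left.1 hdisj.1 h hf)
    (fun P hP => dif_neg fun h => Set.disjoint_left.1 hdisj.2 h hP) φ _

end Amalgam

/-- Interpretations over disjoint signatures whose domains have the same cardinalities and which
satisfy the same equations between variables of index at most `n` of the shared sorts have a common
expansion, as far as these variables are concerned. -/
theorem exists_amalgam (hdisj : L₁.IsDisjoint L₂) {T₁ : Theory L₁} {T₂ : Theory L₂}
    (A : Interpretation.{u} L₁) (B : Interpretation.{u} L₂) (hA : A.Models T₁)
    (hB : B.Models T₂) (n : ℕ)
    (hcard : ∀ s ∈ L₁.sorts, s ∈ L₂.sorts → A.card s = B.card s)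
    (heq : ∀ s h₁ h₂, ∀ c ≤ n, ∀ c' ≤ n,
      A.asg s h₁ c = A.asg s h₁ c' ↔ B.asg s h₂ c = B.asg s h₂ c') :
    ∃ I : Interpretation.{u} (L₁.union L₂), I.Models (T₁.union T₂) ∧
      (∀ ψ : Formula L₁, (∀ v ∈ ψ.freeVars, v.2 ≤ n) →
        (I.Satisfies (ψ.incl (L₁.sub_union_left L₂)) ↔ A.Satisfies ψ)) ∧
      (∀ ψ : Formula L₂, (∀ v ∈ ψ.freeVars, v.2 ≤ n) →
        (I.Satisfies (ψ.incl (L₁.sub_union_right L₂)) ↔ B.Satisfies ψ)) := by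
  obtain ⟨C, e₁, e₂, he⟩ := exists_common_carrier A B n hcard heq
  let M := A.str.amalgam B.str e₁ e₂
  -- Variables of shared sorts take their values from `A`. For indices above n these may differ from
  -- the values in `B`, which is why agreement with `B` is limited to formulas whose variables have
  -- index at most n.
  let ν : Assignment M := fun s hs i => if h : s ∈ L₁.sorts then e₁ s h (A.asg s h i)
    else e₂ s ((Finset.mem_union.1 hs).resolve_left h) 
      (B.asg s ((Finset.mem_union.1 hs).resolve_left h) i)
  have hν₁ : ∀ s h i, ν.reduct (L₁.sub_union_left L₂) s h i = A.asg.transport e₁ s h i :=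
    fun s h i => dif_pos h
  have hν₂ : ∀ s h i, i ≤ n →
      ν.reduct (L₁.sub_union_right L₂) s h i = B.asg.transport e₂ s h i := by
    intro s h i hi
    by_cases h₁ : s ∈ L₁.sorts
    · exact (dif_pos h₁).trans (he s h₁ h i hi)
    · exact dif_neg h₁
  have key₁ : ∀ ψ : Formula L₁, (∀ v ∈ ψ.freeVars, v.2 ≤ n) →
      (ψ.Realize (M.reduct (L₁.sub_union_left L₂)) (ν.reduct _) ↔ A.Satisfies ψ) :=
    fun ψ _ => (ψ.realize_congr fun s hs i _ => hν₁ s hs i).trans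
      (ψ.realize_amalgam_left A.str B.str e₁ e₂ A.asg)
  have key₂ : ∀ ψ : Formula L₂, (∀ v ∈ ψ.freeVars, v.2 ≤ n) →
      (ψ.Realize (M.reduct (L₁.sub_union_right L₂)) (ν.reduct _) ↔ B.Satisfies ψ) :=
    fun ψ h => (ψ.realize_congr fun s hs i hi => hν₂ s hs i (h _ hi)).trans
      (ψ.realize_amalgam_right A.str B.str e₁ e₂ hdisj B.asg)
  refine ⟨⟨M, ν⟩, (Theory.models_union_iff M ν).2 ⟨fun ψ hψ => ?_, fun ψ hψ => ?_⟩,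
    fun ψ h => ?_, fun ψ h => ?_⟩
  · exact (key₁ ψ.1 (by simp [ψ.2])).2 (hA ψ hψ)
  · exact (key₂ ψ.1 (by simp [ψ.2])).2 (hB ψ hψ)
  · exact (Formula.realize_incl _ M ψ ν).trans (key₁ ψ h)
  · exact (Formula.realize_incl _ M ψ ν).trans (key₂ ψ h)

/-- The combination theorem: a model of `T₁` of finite size below the size of a model of `T₂` can be
adjusted to be amalgamated with (a countable elementary substructure of) the latter. -/
theorem exists_amalgam_of_finitelySmooth (hdisj : L₁.IsDisjoint L₂) {T₁ : Theory L₁}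
    {T₂ : Theory L₂} (hfs : T₁.FinitelySmooth.{u} (L₁.sorts ∩ L₂.sorts)) {φ₁ : Formula L₁}
    {φ₂ : Formula L₂} (hφ₁ : φ₁.IsQF) (A : Interpretation.{u} L₁) (B : Interpretation.{u} L₂)
    (hA : A.Models T₁) (hAφ : A.Satisfies φ₁) (hB : B.Models T₂) (hBφ : B.Satisfies φ₂)
    (hfin : ∀ s ∈ L₁.sorts ∩ L₂.sorts, A.card s < Cardinal.aleph0)
    (hle : ∀ s ∈ L₁.sorts ∩ L₂.sorts, A.card s ≤ B.card s) (n : ℕ)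
    (heq : ∀ (A : Interpretation.{u} L₁) (B : Interpretation.{u} L₂), A.Satisfies φ₁ →
      B.Satisfies φ₂ → ∀ s h₁ h₂, ∀ c ≤ n, ∀ c' ≤ n,
        (A.asg s h₁ c = A.asg s h₁ c' ↔ B.asg s h₂ c = B.asg s h₂ c')) :
    ∃ (I : Interpretation.{u} (L₁.union L₂)) (A : Interpretation.{u} L₁)
      (B : Interpretation.{u} L₂), I.Models (T₁.union T₂) ∧ A.Satisfies φ₁ ∧ B.Satisfies φ₂ ∧
      (∀ ψ : Formula L₁, (∀ v ∈ ψ.freeVars, v.2 ≤ n) →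
        (I.Satisfies (ψ.incl (L₁.sub_union_left L₂)) ↔ A.Satisfies ψ)) ∧
      (∀ ψ : Formula L₂, (∀ v ∈ ψ.freeVars, v.2 ≤ n) →
        (I.Satisfies (ψ.incl (L₁.sub_union_right L₂)) ↔ B.Satisfies ψ)) := by
  -- The target size is that of `B`. The new model is related to `A` only through φ₁, so the
  -- equalities between variables must be consequences of the formulas; hence `heq` ranges over all
  -- interpretations.
  obtain ⟨A', hA', hAφ', hAc⟩ := hfs.exists_card_eq_min Finset.inter_subset_left hφ₁ hA hAφ
    hfin hle
  obtain ⟨B', hBB, hBc⟩ := B.exists_countable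
  have hBφ' := (hBB φ₂).2 hBφ
  obtain ⟨I, hI, h₁, h₂⟩ := exists_amalgam hdisj (T₁ := T₁) (T₂ := T₂) A' B' hA'
    (fun ψ hψ => (hBB _).2 (hB ψ hψ)) n
    (fun s hs₁ hs₂ => by rw [hAc s (Finset.mem_inter.2 ⟨hs₁, hs₂⟩), hBc s hs₂])
    (heq A' B' hAφ' hBφ')
  exact ⟨I, A', B', hI, hAφ', hBφ', h₁, h₂⟩

/-! ## Operations on Gödel numbers -/

/-- The Gödel number of a variable. -/
def varCode (s i : ℕ) : ℕ := Nat.pair 0 (Nat.pair s i)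

/-- The Gödel number of an equation. -/
def eqCode (s a b : ℕ) : ℕ := Nat.pair 0 (Nat.pair s (Nat.pair a b))

/-- The Gödel number of the application of a function or predicate symbol. -/
def appCode (x : ℕ) (l : List ℕ) : ℕ := Nat.pair 1 (Nat.pair x (Encodable.encode l))

/-- The Gödel number of a negation. -/
def negCode (a : ℕ) : ℕ := Nat.pair 2 a

/-- The Gödel number of a conjunction. -/
def andCode (a b : ℕ) : ℕ := Nat.pair 3 (Nat.pair a b)

/-- The symbol of an application. -/
def symCode (c : ℕ) : ℕ := c.unpair.2.unpair.1

/-- The arguments of an application. -/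
def argCodes (c : ℕ) : List ℕ := Denumerable.ofNat (List ℕ) c.unpair.2.unpair.2

/-- The argument sorts of a function symbol. -/
def funDom (x : ℕ) : List ℕ := (Denumerable.ofNat (ℕ × List ℕ × ℕ) x).2.1

/-- The value sort of a function symbol. -/
def funCod (x : ℕ) : ℕ := (Denumerable.ofNat (ℕ × List ℕ × ℕ) x).2.2

/-- The argument sorts of a predicate symbol. -/
def predDom (x : ℕ) : List ℕ := (Denumerable.ofNat (ℕ × List ℕ) x).2

@[simp] theorem symCode_appCode (x : ℕ) (l : List ℕ) : symCode (appCode x l) = x := by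
  simp [symCode, appCode]

@[simp] theorem argCodes_appCode (x : ℕ) (l : List ℕ) : argCodes (appCode x l) = l := by
  simp [argCodes, appCode]

@[simp] theorem funDom_code (f : FunSym) : funDom f.code = f.dom := by
  simp [funDom, FunSym.code]

@[simp] theorem funCod_code (f : FunSym) : funCod f.code = f.cod := by
  simp [funCod, FunSym.code]

@[simp] theorem predDom_code (P : PredSym) : predDom P.code = P.dom := by
  simp [predDom, PredSym.code]

theorem FunSym.code_surjective : Function.Surjective FunSym.code := fun x =>
  ⟨⟨(Denumerable.ofNat (ℕ × List ℕ × ℕ) x).1, funDom x, funCod x⟩,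
    Denumerable.encode_ofNat (α := ℕ × List ℕ × ℕ) x⟩

theorem PredSym.code_surjective : Function.Surjective PredSym.code := fun x =>
  ⟨⟨(Denumerable.ofNat (ℕ × List ℕ) x).1, predDom x⟩,
    Denumerable.encode_ofNat (α := ℕ × List ℕ) x⟩

theorem appCode_symCode_argCodes {c : ℕ} (h : c.unpair.1 = 1) :
    appCode (symCode c) (argCodes c) = c := by
  simp only [appCode, symCode, argCodes, Denumerable.encode_ofNat, Nat.pair_unpair]
  rw [← h, Nat.pair_unpair]

/-- The sort of the term with Gödel number `c`. -/
def sortCode (c : ℕ) : ℕ :=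
  if c.unpair.1 = 0 then c.unpair.2.unpair.1 else funCod (symCode c)

@[simp] theorem sortCode_code {s : ℕ} (t : Term L s) : sortCode t.code = s := by
  cases t with
  | var s hs i => simp [sortCode, Term.code]
  | app f hf args =>
    have := funCod_code f
    simp [sortCode, Term.code, symCode]

/-- The variable naming the term with Gödel number `c`. -/
def flatTerm (c : ℕ) : ℕ := varCode (sortCode c) c

/-- Replace the arguments of an application by the variables naming them. -/
def flatApp (c : ℕ) : ℕ := appCode (symCode c) ((argCodes c).map flatTerm)

/-- Replace the arguments of an atom by the variables naming them. -/
def flatAtom (c : ℕ) : ℕ :=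
  if c.unpair.1 = 0 then
    eqCode c.unpair.2.unpair.1 (varCode c.unpair.2.unpair.1 c.unpair.2.unpair.2.unpair.1)
      (varCode c.unpair.2.unpair.1 c.unpair.2.unpair.2.unpair.2)
  else flatApp c

/-- The equation defining the variable naming the term with Gödel number `c`. -/
def flatDef (c : ℕ) : ℕ := eqCode (sortCode c) (flatApp c) (flatTerm c)

/-! ## Flat formulas -/

/-- An equation between variables. -/
def Formula.flatEq (s : ℕ) (hs : s ∈ L.sorts) (i j : ℕ) : Formula L :=
  .eq s hs (.var s hs i) (.var s hs j)

/-- A predicate symbol applied to variables. -/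
def Formula.flatRel (P : PredSym) (hP : P ∈ L.preds) (a : Fin P.dom.length → ℕ) : Formula L :=
  .rel P hP fun i => .var _ (L.get_dom_pred_mem hP i) (a i)

/-- An equation between a function symbol applied to variables and a variable. -/
def Formula.flatFun (f : FunSym) (hf : f ∈ L.funs) (a : Fin f.dom.length → ℕ) (j : ℕ) :
    Formula L :=
  .eq f.cod (L.cod_funs f hf) (.app f hf fun i => .var _ (L.get_dom_fun_mem hf i) (a i))
    (.var f.cod (L.cod_funs f hf) j)

theorem Formula.code_flatEq (s : ℕ) (hs : s ∈ L.sorts) (hs' : s ∈ L'.sorts) (t t' : Term L s) :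
    (Formula.flatEq (L := L') s hs' t.code t'.code).code = flatAtom (Formula.eq s hs t t').code := by
  simp [Formula.flatEq, Formula.code, Term.code, flatAtom, eqCode, varCode]

theorem map_flatTerm_ofFn {n : ℕ} {s : Fin n → ℕ} (t : (i : Fin n) → Term L (s i)) :
    (List.ofFn fun i => (t i).code).map flatTerm =
      List.ofFn fun i => varCode (s i) (t i).code := by
  simp [List.map_ofFn, Function.comp_def, flatTerm]

theorem Formula.code_flatRel (P : PredSym) (hP : P ∈ L.preds) (hP' : P ∈ L'.preds)
    (args : (i : Fin P.dom.length) → Term L (P.dom.get i)) :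
    (Formula.flatRel (L := L') P hP' fun i => (args i).code).code =
      flatAtom (Formula.rel P hP args).code := by
  have h : (Formula.rel P hP args).code = appCode P.code (List.ofFn fun i => (args i).code) := rfl
  have h1 : (Formula.rel P hP args).code.unpair.1 = 1 := by simp [Formula.code]
  rw [flatAtom, h1, if_neg one_ne_zero, h, flatApp, symCode_appCode, argCodes_appCode,
    map_flatTerm_ofFn]
  rfl

theorem Formula.code_flatFun (f : FunSym) (hf : f ∈ L.funs) (hf' : f ∈ L'.funs)
    (args : (i : Fin f.dom.length) → Term L (f.dom.get i)) :
    (Formula.flatFun (L := L') f hf' (fun i => (args i).code) (Term.app f hf args).code).code =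
      flatDef (Term.app f hf args).code := by
  have h : (Term.app f hf args).code = appCode f.code (List.ofFn fun i => (args i).code) := rfl
  rw [flatDef, flatTerm, sortCode_code, flatApp]
  nth_rw 2 3 [h]
  rw [symCode_appCode, argCodes_appCode, map_flatTerm_ofFn]
  rfl

/-! ## Deciding well-formedness -/

open Classical in
/-- The sort of the term with Gödel number `c`, if there is one. -/
noncomputable def termSort (L : Signature) (c : ℕ) : Option ℕ :=
  if ∃ s, ∃ t : Term L s, t.code = c then some (sortCode c) else none

theorem termSort_eq_some_iff {c s : ℕ} :
    termSort L c = some s ↔ ∃ t : Term L s, t.code = c := by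
  unfold termSort
  constructor
  · intro h
    split_ifs at h with hc
    obtain ⟨s', t, rfl⟩ := hc
    rw [sortCode_code] at h
    obtain rfl := Option.some_inj.1 h
    exact ⟨t, rfl⟩
  · rintro ⟨t, rfl⟩
    rw [if_pos ⟨s, t, rfl⟩, sortCode_code]

@[simp] theorem termSort_code {s : ℕ} (t : Term L s) : termSort L t.code = some s :=
  termSort_eq_some_iff.2 ⟨t, rfl⟩

/-- An equation which is a formula if and only if the function symbol belongs to the signature. -/
def testFun (x : ℕ) : ℕ :=
  eqCode (funCod x) (appCode x ((funDom x).map fun s => varCode s 0))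
    (appCode x ((funDom x).map fun s => varCode s 0))

/-- An atom which is a formula if and only if the predicate symbol belongs to the signature. -/
def testPred (x : ℕ) : ℕ := appCode x ((predDom x).map fun s => varCode s 0)

theorem Term.mem_funs_of_code_eq {s : ℕ} (t : Term L s) {f : FunSym} {l : List ℕ}
    (h : t.code = appCode f.code l) : f ∈ L.funs := by
  cases t with
  | var s hs i => simp [Term.code, appCode] at h
  | app g hg args =>
    simp only [Term.code, appCode, Nat.pair_eq_pair] at h
    rwa [← FunSym.code_injective h.2.1]

/-- Membership of a symbol in the signature is thereby reduced to well-formedness of one computable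
number. -/
theorem exists_code_eq_testFun (f : FunSym) :
    (∃ φ : Formula L, φ.IsQF ∧ φ.code = testFun f.code) ↔ f ∈ L.funs := by
  constructor
  · rintro ⟨φ, -, hφ⟩
    cases φ <;> simp only [Formula.code, testFun, eqCode, Nat.pair_eq_pair] at hφ <;> try omega
    rename_i s hs t t'
    exact t.mem_funs_of_code_eq hφ.2.2.1
  · intro hf
    let t : Term L f.cod := .app f hf fun i => .var _ (L.get_dom_fun_mem hf i) 0
    refine ⟨.eq f.cod (L.cod_funs f hf) t t, trivial, ?_⟩
    have ht : t.code = appCode f.code (f.dom.map fun s => varCode s 0) := by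
      have : (List.ofFn fun i => varCode (f.dom.get i) 0) = f.dom.map fun s => varCode s 0 :=
        List.ofFn_getElem_eq_map f.dom fun s => varCode s 0
      rw [appCode, ← this]
      rfl
    simp [Formula.code, testFun, eqCode, ht]

theorem exists_code_eq_testPred (P : PredSym) :
    (∃ φ : Formula L, φ.IsQF ∧ φ.code = testPred P.code) ↔ P ∈ L.preds := by
  constructor
  · rintro ⟨φ, -, hφ⟩
    cases φ <;> simp only [Formula.code, testPred, appCode, Nat.pair_eq_pair] at hφ <;> try omega
    rename_i Q hQ args
    rwa [← PredSym.code_injective hφ.2.1]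
  · intro hP
    refine ⟨.rel P hP fun i => .var _ (L.get_dom_pred_mem hP i) 0, trivial, ?_⟩
    have : (List.ofFn fun i => varCode (P.dom.get i) 0) = P.dom.map fun s => varCode s 0 :=
      List.ofFn_getElem_eq_map P.dom fun s => varCode s 0
    rw [testPred, predDom_code, appCode, ← this]
    rfl

/-- One step of the computation of `termSort`, given the list of its earlier values. Here `F`
decides which function symbols belong to the signature. -/
def termSortStep (S : Finset ℕ) (F : ℕ → Bool) (p : List (Option ℕ)) : Option ℕ :=
  -- `p` holds the values at all smaller numbers, so `p.length` is the number under examination.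
  if p.length.unpair.1 = 0 then
    if p.length.unpair.2.unpair.1 ∈ S then some p.length.unpair.2.unpair.1 else none
  else if p.length.unpair.1 = 1 ∧ F (symCode p.length) = true ∧
      (argCodes p.length).map (fun a => (p[a]?).getD none) =
        (funDom (symCode p.length)).map some then
    some (funCod (symCode p.length))
  else none

/-- Turns a computable check on a list of codes into the dependent family of arguments that
`Term.app` and `Formula.rel` take. -/
theorem map_termSort_eq_iff {l d : List ℕ} :
    l.map (termSort L) = d.map some ↔
      ∃ t : (i : Fin d.length) → Term L (d.get i), l = List.ofFn fun i => (t i).code := by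
  constructor
  · intro h
    have hl : l.length = d.length := by simpa using congrArg List.length h
    have : ∀ i : Fin d.length, ∃ t : Term L (d.get i), t.code = l[i]'(by omega) := by
      intro i
      rw [← termSort_eq_some_iff]
      have := congrArg (fun l => l[(i : ℕ)]?) h
      simpa [hl] using this
    choose t ht using this
    refine ⟨t, List.ext_getElem (by simpa using hl) fun i h1 h2 => ?_⟩
    simp [ht]
  · rintro ⟨t, rfl⟩
    refine List.ext_getElem (by simp) fun i h1 h2 => ?_
    simp

theorem argCodes_lt {c : ℕ} (h : c.unpair.1 = 1) {a : ℕ} (ha : a ∈ argCodes c) : a < c := by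
  rw [← appCode_symCode_argCodes h]
  exact lt_pair_of_le_right one_pos (le_pair_of_le_right (le_encode_of_mem ha))

/-- Arguments have smaller codes than their application, so `termSort`, although defined by a
classical existence statement, obeys a course-of-values recursion. -/
theorem termSortStep_eq {F : ℕ → Bool} (hF : ∀ f : FunSym, F f.code = true ↔ f ∈ L.funs)
    (c : ℕ) :
    termSortStep L.sorts F ((List.range c).map (termSort L)) = termSort L c := by
  refine Option.ext fun s => ?_
  rw [termSort_eq_some_iff]
  simp only [termSortStep, List.length_map, List.length_range]
  split_ifs with h0 h1 h1
  · rw [Option.some_inj]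
    constructor
    · rintro rfl
      refine ⟨.var _ h1 c.unpair.2.unpair.2, ?_⟩
      rw [Term.code, Nat.pair_unpair, ← h0, Nat.pair_unpair]
    · rintro ⟨t, rfl⟩
      cases t
      · simp [Term.code]
      · simp [Term.code] at h0
  · simp only [false_iff]
    rintro ⟨t, rfl⟩
    have hs := t.sort_mem
    cases t
    · simp only [Term.code, Nat.unpair_pair] at h1
      exact h1 hs
    · simp [Term.code] at h0
  · obtain ⟨h1, hf, ha⟩ := h1
    obtain ⟨f, hfc⟩ := FunSym.code_surjective (symCode c)
    rw [← hfc] at hf ha ⊢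
    rw [hF] at hf
    rw [Option.some_inj, funCod_code]
    have ha' : (argCodes c).map (termSort L) = f.dom.map some := by
      rw [← funDom_code f, ← ha]
      refine List.map_congr_left fun a ha => ?_
      simp [argCodes_lt h1 ha]
    obtain ⟨t, ht⟩ := map_termSort_eq_iff.1 ha'
    have hc : (Term.app f hf t).code = c := by
      rw [← appCode_symCode_argCodes h1, ← hfc, ht]
      rfl
    constructor
    · rintro rfl
      exact ⟨_, hc⟩
    · rintro ⟨t', ht'⟩
      exact Term.sort_eq_of_code_eq (hc.trans ht'.symm)
  · simp only [false_iff]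
    rintro ⟨t, rfl⟩
    cases t with
    | var s hs i => simp [Term.code] at h0
    | app f hf args =>
      refine h1 ⟨by simp [Term.code], ?_, ?_⟩
      · have : symCode (Term.app f hf args).code = f.code := by simp [Term.code, symCode]
        rw [this, hF]
        exact hf
      · have h2 : symCode (Term.app f hf args).code = f.code := by simp [Term.code, symCode]
        have h3 : argCodes (Term.app f hf args).code = List.ofFn fun i => (args i).code := by
          simp [Term.code, argCodes]
        rw [h2, funDom_code, ← map_termSort_eq_iff.2 ⟨args, h3⟩]
        refine List.map_congr_left fun a ha => ?_
        simp [argCodes_lt (by simp [Term.code]) ha]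

/-! ## Evaluating quantifier-free formulas under a valuation of the atoms -/

/-- The truth value of a quantifier-free formula under a valuation of the atoms. -/
def Formula.boolEval (θ : ℕ → Bool) : Formula L → Bool
  | .eq s hs t t' => θ (Formula.eq s hs t t').code
  | .rel P hP args => θ (Formula.rel P hP args).code
  | .neg φ => !φ.boolEval θ
  | .and φ ψ => φ.boolEval θ && ψ.boolEval θ
  | .all _ _ _ _ => false

open Classical in
/-- The truth value of the quantifier-free formula with Gödel number `c`, if there is one. -/
noncomputable def evalCode (L : Signature) (θ : ℕ → Bool) (c : ℕ) : Option Bool :=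
  if h : ∃ φ : Formula L, φ.IsQF ∧ φ.code = c then some (h.choose.boolEval θ) else none

theorem evalCode_eq_some_iff {θ : ℕ → Bool} {c : ℕ} {b : Bool} :
    evalCode L θ c = some b ↔ ∃ φ : Formula L, φ.IsQF ∧ φ.code = c ∧ φ.boolEval θ = b := by
  unfold evalCode
  constructor
  · intro h
    split_ifs at h with hc
    exact ⟨_, hc.choose_spec.1, hc.choose_spec.2, Option.some_inj.1 h⟩
  · rintro ⟨φ, hφ, rfl, rfl⟩
    have h : ∃ ψ : Formula L, ψ.IsQF ∧ ψ.code = φ.code := ⟨φ, hφ, rfl⟩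
    rw [dif_pos h, Formula.code_injective h.choose_spec.2]

/-- Whether `c` is the Gödel number of an atom. Here `τ` computes the sorts of terms and `R`
decides which predicate symbols belong to the signature. -/
def isAtom (τ : ℕ → Option ℕ) (R : ℕ → Bool) (c : ℕ) : Bool :=
  if c.unpair.1 = 0 then
    decide (τ c.unpair.2.unpair.2.unpair.1 = some c.unpair.2.unpair.1) &&
      decide (τ c.unpair.2.unpair.2.unpair.2 = some c.unpair.2.unpair.1)
  else decide (c.unpair.1 = 1) && (R (symCode c) &&
    decide ((argCodes c).map τ = (predDom (symCode c)).map some))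

/-- One step of the computation of `evalCode`, given the list of its earlier values. -/
def evalCodeStep (τ : ℕ → Option ℕ) (R : ℕ → Bool) (θ : ℕ → Bool) (p : List (Option Bool)) :
    Option Bool :=
  if p.length.unpair.1 = 2 then
    ((p[p.length.unpair.2]?).getD none).map fun b => !b
  else if p.length.unpair.1 = 3 then
    ((p[p.length.unpair.2.unpair.1]?).getD none).bind fun b =>
      ((p[p.length.unpair.2.unpair.2]?).getD none).map fun b' => b && b'
  else if isAtom τ R p.length then some (θ p.length)
  else none

/-- Once the tags of negation and conjunction are excluded, a quantifier-free formula can only be an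
atom. -/
theorem isAtom_iff {R : ℕ → Bool} (hR : ∀ P : PredSym, R P.code = true ↔ P ∈ L.preds) {c : ℕ}
    (h2 : c.unpair.1 ≠ 2) (h3 : c.unpair.1 ≠ 3) :
    isAtom (termSort L) R c = true ↔ ∃ φ : Formula L, φ.IsQF ∧ φ.code = c := by
  unfold isAtom
  split_ifs with h0
  · simp only [Bool.and_eq_true, decide_eq_true_eq, termSort_eq_some_iff]
    constructor
    · rintro ⟨⟨t, ht⟩, ⟨t', ht'⟩⟩
      refine ⟨.eq _ t.sort_mem t t', trivial, ?_⟩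
      rw [Formula.code, ht, ht', Nat.pair_unpair, Nat.pair_unpair, ← h0, Nat.pair_unpair]
    · rintro ⟨φ, hφ, rfl⟩
      cases φ with
      | eq s hs t t' =>
        simp only [← termSort_eq_some_iff]
        simp [Formula.code]
      | _ => simp [Formula.code] at h0
  · simp only [Bool.and_eq_true, decide_eq_true_eq]
    constructor
    · rintro ⟨h1, hP, ha⟩
      obtain ⟨P, hPc⟩ := PredSym.code_surjective (symCode c)
      rw [← hPc] at hP ha
      rw [predDom_code] at ha
      obtain ⟨t, ht⟩ := map_termSort_eq_iff.1 ha
      refine ⟨.rel P ((hR P).1 hP) t, trivial, ?_⟩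
      rw [← appCode_symCode_argCodes h1, ← hPc, ht]
      rfl
    · rintro ⟨φ, hφ, rfl⟩
      cases φ with
      | rel P hP args =>
        have h4 : symCode (Formula.rel P hP args).code = P.code := by
          simp [Formula.code, symCode]
        have h5 : argCodes (Formula.rel P hP args).code = List.ofFn fun i => (args i).code := by
          simp [Formula.code, argCodes]
        rw [h4, predDom_code]
        exact ⟨by simp [Formula.code], (hR P).2 hP, map_termSort_eq_iff.2 ⟨args, h5⟩⟩
      | all s hs i φ => exact hφ.elim
      | _ => simp [Formula.code] at h0 h2 h3

theorem getElem?_map_range_getD {α : Type*} (f : ℕ → Option α) {a c : ℕ} (h : a < c) :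
    (((List.range c).map f)[a]?).getD none = f a := by
  simp [h]

theorem evalCodeStep_eq {R : ℕ → Bool} (hR : ∀ P : PredSym, R P.code = true ↔ P ∈ L.preds)
    (θ : ℕ → Bool) (c : ℕ) :
    evalCodeStep (termSort L) R θ ((List.range c).map (evalCode L θ)) = evalCode L θ c := by
  refine Option.ext fun b => ?_
  rw [evalCode_eq_some_iff]
  simp only [evalCodeStep, List.length_map, List.length_range]
  split_ifs with h2 h3 h
  · have hc : c = Nat.pair 2 c.unpair.2 := by rw [← h2, Nat.pair_unpair]
    have hlt : c.unpair.2 < c := by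
      conv_rhs => rw [hc]
      exact lt_pair_of_le_right two_pos le_rfl
    rw [getElem?_map_range_getD _ hlt, Option.map_eq_some_iff]
    simp only [evalCode_eq_some_iff]
    constructor
    · rintro ⟨_, ⟨φ, hφ, hφc, rfl⟩, rfl⟩
      exact ⟨.neg φ, hφ, by rw [Formula.code, hφc, ← hc], rfl⟩
    · rintro ⟨φ, hφ, hφc, rfl⟩
      rw [hc] at hφc
      cases φ <;> simp only [Formula.code, Nat.pair_eq_pair] at hφc <;> try omega
      rename_i ψ
      exact ⟨ψ.boolEval θ, ⟨ψ, hφ, hφc.2, rfl⟩, rfl⟩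
  · have hc : c = Nat.pair 3 (Nat.pair c.unpair.2.unpair.1 c.unpair.2.unpair.2) := by
      rw [Nat.pair_unpair, ← h3, Nat.pair_unpair]
    have hlt₁ : c.unpair.2.unpair.1 < c := by
      conv_rhs => rw [hc]
      exact lt_pair_of_le_right three_pos (le_pair_of_le_left le_rfl)
    have hlt₂ : c.unpair.2.unpair.2 < c := by
      conv_rhs => rw [hc]
      exact lt_pair_of_le_right three_pos (le_pair_of_le_right le_rfl)
    rw [getElem?_map_range_getD _ hlt₁, getElem?_map_range_getD _ hlt₂, Option.bind_eq_some_iff]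
    simp only [Option.map_eq_some_iff, evalCode_eq_some_iff]
    constructor
    · rintro ⟨_, ⟨φ, hφ, hφc, rfl⟩, _, ⟨ψ, hψ, hψc, rfl⟩, rfl⟩
      exact ⟨.and φ ψ, ⟨hφ, hψ⟩, by rw [Formula.code, hφc, hψc, ← hc], rfl⟩
    · rintro ⟨φ, hφ, hφc, rfl⟩
      rw [hc] at hφc
      cases φ <;> simp only [Formula.code, Nat.pair_eq_pair] at hφc <;> try omega
      rename_i ψ ψ'
      exact ⟨ψ.boolEval θ, ⟨ψ, hφ.1, hφc.2.1, rfl⟩, ψ'.boolEval θ, ⟨ψ', hφ.2, hφc.2.2, rfl⟩, rfl⟩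
  · obtain ⟨φ, hφ, rfl⟩ := (isAtom_iff hR h2 h3).1 h
    have hφθ : φ.boolEval θ = θ φ.code := by
      cases φ with
      | eq s hs t t' => rfl
      | rel P hP args => rfl
      | all s hs i φ => exact hφ.elim
      | _ => simp [Formula.code] at h2 h3
    rw [Option.some_inj, ← hφθ]
    constructor
    · rintro rfl
      exact ⟨φ, hφ, rfl, rfl⟩
    · rintro ⟨ψ, -, hψ, rfl⟩
      rw [Formula.code_injective hψ]
  · simp only [false_iff]
    rintro ⟨φ, hφ, hφc, -⟩
    exact h ((isAtom_iff hR h2 h3).2 ⟨φ, hφ, hφc⟩)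

/-! ## Computable functions -/

section Computable

variable {α β σ : Type*} [Primcodable α] [Primcodable β] [Primcodable σ]

/-- Obtained by primitive recursion on the length: the n-th value is the fold over the first n
entries, and an index past the end leaves the accumulator unchanged. -/
theorem computable_list_foldl {f : α → List β} {g : α → σ} {h : α → σ → β → σ}
    (hf : Computable f) (hg : Computable g)
    (hh : Computable fun p : α × σ × β => h p.1 p.2.1 p.2.2) :
    Computable fun a => (f a).foldl (h a) (g a) := by
  have step : Computable₂ fun (a : α) (q : ℕ × σ) =>
      Option.casesOn (motive := fun _ => σ) ((f a)[q.1]?) q.2 fun b => h a q.2 b :=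
    Computable.option_casesOn
      (Computable.list_getElem?.comp (hf.comp Computable.fst)
        (Computable.fst.comp Computable.snd))
      (Computable.snd.comp Computable.snd)
      (hh.comp ((Computable.fst.comp Computable.fst).pair
        ((Computable.snd.comp (Computable.snd.comp Computable.fst)).pair Computable.snd)))
  refine (Computable.nat_rec (Computable.list_length.comp hf) hg step).of_eq fun a => ?_
  have key : ∀ n, (Nat.rec (motive := fun _ => σ) (g a) (fun y IH =>
      Option.casesOn (motive := fun _ => σ) ((f a)[y]?) IH fun b => h a IH b) n : σ) =
      ((f a).take n).foldl (h a) (g a) := by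
    intro n
    induction n with
    | zero => simp
    | succ n ih =>
      simp only [ih]
      rcases lt_or_ge n (f a).length with hn | hn
      · rw [List.take_add_one, List.getElem?_eq_getElem hn, Option.toList_some,
          List.foldl_append]
        rfl
      · rw [List.getElem?_eq_none hn, List.take_of_length_le hn,
          List.take_of_length_le (hn.trans (Nat.le_succ n))]
  simpa using key (f a).length

theorem computable_list_flatMap {f : α → List β} {g : α → β → List σ} (hf : Computable f)
    (hg : Computable₂ g) : Computable fun a => (f a).flatMap (g a) := by
  refine (computable_list_foldl (h := fun a acc b => acc ++ g a b) hf (Computable.const [])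
    (Computable.list_append.comp (Computable.fst.comp Computable.snd)
      (hg.comp Computable.fst (Computable.snd.comp Computable.snd)))).of_eq fun a => ?_
  have : ∀ (l : List β) (acc : List σ),
      l.foldl (fun acc b => acc ++ g a b) acc = acc ++ l.flatMap (g a) := by
    intro l
    induction l with
    | nil => simp
    | cons b l ih => intro acc; simp [ih]
  simpa using this (f a) []

theorem computable_list_map {f : α → List β} {g : α → β → σ} (hf : Computable f)
    (hg : Computable₂ g) : Computable fun a => (f a).map (g a) := by
  have hg' : Computable fun p : α × β => g p.1 p.2 := hg
  have h : Computable₂ fun a b => [g a b] :=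
    Computable.list_cons.comp hg' (Computable.const [])
  exact (computable_list_flatMap hf h).of_eq fun a => List.map_eq_flatMap.symm

theorem computable_list_any {f : α → List β} {g : α → β → Bool} (hf : Computable f)
    (hg : Computable₂ g) : Computable fun a => (f a).any (g a) := by
  refine (computable_list_foldl (h := fun a acc b => acc || g a b) hf (Computable.const false)
    (Primrec.or.to_comp.comp (Computable.fst.comp Computable.snd)
      (hg.comp Computable.fst (Computable.snd.comp Computable.snd)))).of_eq fun a => ?_
  have : ∀ (l : List β) (acc : Bool),
      l.foldl (fun acc b => acc || g a b) acc = (acc || l.any (g a)) := by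
    intro l
    induction l with
    | nil => simp
    | cons b l ih => intro acc; simp [ih, Bool.or_assoc]
  simpa using this (f a) false

theorem computablePred_eq {f g : α → β} (hf : Computable f) (hg : Computable g) :
    ComputablePred fun a => f a = g a := by
  classical
  exact ⟨inferInstance, (Primrec.eq.decide.to_comp.comp hf hg).of_eq fun _ => rfl⟩

theorem computablePred_and {p q : α → Prop} (hp : ComputablePred p) (hq : ComputablePred q) :
    ComputablePred fun a => p a ∧ q a := by
  classical
  exact ⟨inferInstance, (Primrec.and.to_comp.comp hp.decide hq.decide).of_eq fun _ => by simp⟩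

theorem computablePred_mem (S : Finset ℕ) {f : α → ℕ} (hf : Computable f) :
    ComputablePred fun a => f a ∈ S := by
  classical
  refine ⟨inferInstance, (computable_list_any (f := fun _ => S.toList)
    (g := fun a b => decide (f a = b)) (Computable.const _)
    (computablePred_eq (hf.comp Computable.fst) Computable.snd).decide).of_eq fun a => ?_⟩
  rw [Bool.eq_iff_iff]
  simp

theorem computable_ite {p : α → Prop} [DecidablePred p] {f g : α → σ} (hp : ComputablePred p)
    (hf : Computable f) (hg : Computable g) : Computable fun a => if p a then f a else g a :=
  (Computable.cond hp.decide hf hg).of_eq fun _ => Bool.cond_decide ..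

theorem computable_bool_eq_true {f : α → Bool} (hf : Computable f) :
    ComputablePred fun a => f a = true :=
  computablePred_eq hf (Computable.const true)

theorem computable_pair {f g : α → ℕ} (hf : Computable f) (hg : Computable g) :
    Computable fun a => Nat.pair (f a) (g a) :=
  Primrec₂.natPair.to_comp.comp hf hg

theorem computable_unpair_fst {f : α → ℕ} (hf : Computable f) :
    Computable fun a => (f a).unpair.1 :=
  Computable.fst.comp (Computable.unpair.comp hf)

theorem computable_unpair_snd {f : α → ℕ} (hf : Computable f) :
    Computable fun a => (f a).unpair.2 :=
  Computable.snd.comp (Computable.unpair.comp hf)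

theorem computable_varCode {f g : α → ℕ} (hf : Computable f) (hg : Computable g) :
    Computable fun a => varCode (f a) (g a) :=
  computable_pair (Computable.const 0) (computable_pair hf hg)

theorem computable_eqCode {f g h : α → ℕ} (hf : Computable f) (hg : Computable g)
    (hh : Computable h) : Computable fun a => eqCode (f a) (g a) (h a) :=
  computable_pair (Computable.const 0) (computable_pair hf (computable_pair hg hh))

theorem computable_appCode {f : α → ℕ} {g : α → List ℕ} (hf : Computable f)
    (hg : Computable g) : Computable fun a => appCode (f a) (g a) :=
  computable_pair (Computable.const 1) (computable_pair hf (Computable.encode.comp hg))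

theorem computable_negCode : Computable negCode :=
  computable_pair (Computable.const 2) Computable.id

theorem computable_andCode {f g : α → ℕ} (hf : Computable f) (hg : Computable g) :
    Computable fun a => andCode (f a) (g a) :=
  computable_pair (Computable.const 3) (computable_pair hf hg)

theorem computable_symCode : Computable symCode :=
  computable_unpair_fst (computable_unpair_snd Computable.id)

theorem computable_argCodes : Computable argCodes :=
  (Computable.ofNat (List ℕ)).comp (computable_unpair_snd (computable_unpair_snd Computable.id))

theorem computable_funDom : Computable funDom :=
  Computable.fst.comp (Computable.snd.comp (Computable.ofNat (ℕ × List ℕ × ℕ)))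

theorem computable_funCod : Computable funCod :=
  Computable.snd.comp (Computable.snd.comp (Computable.ofNat (ℕ × List ℕ × ℕ)))

theorem computable_predDom : Computable predDom :=
  Computable.snd.comp (Computable.ofNat (ℕ × List ℕ))

theorem computable_sortCode : Computable sortCode :=
  computable_ite (computablePred_eq (computable_unpair_fst Computable.id) (Computable.const 0))
    (computable_unpair_fst (computable_unpair_snd Computable.id))
    (computable_funCod.comp computable_symCode)

theorem computable_flatTerm : Computable flatTerm :=
  computable_varCode computable_sortCode Computable.id

theorem computable_flatApp : Computable flatApp :=
  computable_appCode computable_symCode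
    (computable_list_map computable_argCodes (computable_flatTerm.comp Computable.snd))

theorem computable_flatAtom : Computable flatAtom := by
  have h : Computable fun c : ℕ => c.unpair.2.unpair.1 :=
    computable_unpair_fst (computable_unpair_snd Computable.id)
  have h' : Computable fun c : ℕ => c.unpair.2.unpair.2 :=
    computable_unpair_snd (computable_unpair_snd Computable.id)
  exact computable_ite
    (computablePred_eq (computable_unpair_fst Computable.id) (Computable.const 0))
    (computable_eqCode h (computable_varCode h (computable_unpair_fst h'))
      (computable_varCode h (computable_unpair_snd h')))
    computable_flatApp

theorem computable_flatDef : Computable flatDef :=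
  computable_eqCode computable_sortCode computable_flatApp computable_flatTerm

theorem computable_testFun : Computable testFun := by
  have h : Computable fun x => appCode x ((funDom x).map fun s => varCode s 0) :=
    computable_appCode Computable.id
      (computable_list_map computable_funDom
        (computable_varCode Computable.snd (Computable.const 0)))
  exact computable_eqCode computable_funCod h h

theorem computable_testPred : Computable testPred :=
  computable_appCode Computable.id
    (computable_list_map computable_predDom
      (computable_varCode Computable.snd (Computable.const 0)))

theorem computable_termSortStep (S : Finset ℕ) {F : ℕ → Bool} (hF : Computable F) :
    Computable (termSortStep S F) := by
  have hl : Computable fun p : List (Option ℕ) => p.length := Computable.list_length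
  have hs := computable_symCode.comp hl
  have hx := computable_unpair_fst (computable_unpair_snd hl)
  refine computable_ite (computablePred_eq (computable_unpair_fst hl) (Computable.const 0))
    (computable_ite (computablePred_mem S hx) (Computable.option_some.comp hx)
      (Computable.const none))
    (computable_ite (computablePred_and
      (computablePred_eq (computable_unpair_fst hl) (Computable.const 1))
      (computablePred_and (computable_bool_eq_true (hF.comp hs)) (computablePred_eq ?_ ?_)))
      (Computable.option_some.comp (computable_funCod.comp hs)) (Computable.const none))
  · exact computable_list_map (computable_argCodes.comp hl)
      (Computable.option_getD (Computable.list_getElem?.comp Computable.fst Computable.snd)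
        (Computable.const none))
  · exact computable_list_map (computable_funDom.comp hs)
      (Computable.option_some.comp Computable.snd)

theorem computable_termSort {F : ℕ → Bool} (hF : Computable F)
    (hF' : ∀ f : FunSym, F f.code = true ↔ f ∈ L.funs) : Computable (termSort L) :=
  (Computable.nat_strong_rec (fun _ : Unit => termSort L)
    (g := fun _ p => some (termSortStep L.sorts F p))
    (Computable.option_some.comp ((computable_termSortStep L.sorts hF).comp Computable.snd))
    fun _ n => congrArg some (termSortStep_eq hF' n)).comp (Computable.const ()) Computable.id

theorem computable_isAtom {τ : ℕ → Option ℕ} {R : ℕ → Bool} (hτ : Computable τ)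
    (hR : Computable R) : Computable (isAtom τ R) := by
  have hx : Computable fun c : ℕ => c.unpair.2.unpair.1 :=
    computable_unpair_fst (computable_unpair_snd Computable.id)
  have hy : Computable fun c : ℕ => c.unpair.2.unpair.2 :=
    computable_unpair_snd (computable_unpair_snd Computable.id)
  have h1 : Computable fun c : ℕ => c.unpair.1 := computable_unpair_fst Computable.id
  refine computable_ite (computablePred_eq h1 (Computable.const 0))
    (Primrec.and.to_comp.comp
      (computablePred_eq (hτ.comp (computable_unpair_fst hy))
        (Computable.option_some.comp hx)).decide
      (computablePred_eq (hτ.comp (computable_unpair_snd hy))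
        (Computable.option_some.comp hx)).decide)
    (Primrec.and.to_comp.comp (computablePred_eq h1 (Computable.const 1)).decide
      (Primrec.and.to_comp.comp (hR.comp computable_symCode) (computablePred_eq ?_ ?_).decide))
  · exact computable_list_map computable_argCodes (hτ.comp Computable.snd)
  · exact computable_list_map (computable_predDom.comp computable_symCode)
      (Computable.option_some.comp Computable.snd)

theorem computable_evalCodeStep {τ : ℕ → Option ℕ} {R : ℕ → Bool} (hτ : Computable τ)
    (hR : Computable R) {θ : α → ℕ → Bool} (hθ : Computable₂ θ) :
    Computable₂ fun a p => evalCodeStep τ R (θ a) p := by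
  have hp : Computable fun q : α × List (Option Bool) => q.2 := Computable.snd
  have hl : Computable fun q : α × List (Option Bool) => q.2.length :=
    Computable.list_length.comp hp
  have hget : ∀ {k : α × List (Option Bool) → ℕ}, Computable k →
      Computable fun q => (q.2[k q]?).getD none := fun hk =>
    Computable.option_getD (Computable.list_getElem?.comp hp hk) (Computable.const none)
  have h1 := computable_unpair_fst hl
  have h2 := computable_unpair_snd hl
  refine computable_ite (computablePred_eq h1 (Computable.const 2))
    (Computable.option_map (hget h2) (Primrec.not.to_comp.comp Computable.snd))
    (computable_ite (computablePred_eq h1 (Computable.const 3))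
      (Computable.option_bind (hget (computable_unpair_fst h2)) ?_)
      (computable_ite (computable_bool_eq_true ((computable_isAtom hτ hR).comp hl))
        (Computable.option_some.comp (hθ.comp Computable.fst hl)) (Computable.const none)))
  exact Computable.option_map ((hget (computable_unpair_snd h2)).comp Computable.fst)
    (Primrec.and.to_comp.comp (Computable.snd.comp Computable.fst) Computable.snd)

theorem computable_evalCode {R : ℕ → Bool} (hτ : Computable (termSort L)) (hR : Computable R)
    (hR' : ∀ P : PredSym, R P.code = true ↔ P ∈ L.preds) {θ : α → ℕ → Bool}
    (hθ : Computable₂ θ) : Computable₂ fun a c => evalCode L (θ a) c :=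
  Computable.nat_strong_rec (fun a => evalCode L (θ a))
    (g := fun a p => some (evalCodeStep (termSort L) R (θ a) p))
    (Computable.option_some.comp (computable_evalCodeStep hτ hR hθ))
    fun a n => congrArg some (evalCodeStep_eq hR' (θ a) n)

end Computable

/-! ## Literals -/

/-- The Gödel number of the conjunction of the formulas in the list `l` (each of them negated if it
is paired with `false`) which are formulas according to `W`, and of `base`. -/
def conjCode (W : ℕ → Bool) (base : ℕ) (l : List (ℕ × Bool)) : ℕ :=
  l.foldl (fun acc p => if W p.1 = true then
    andCode (if p.2 = true then p.1 else negCode p.1) acc else acc) base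

/-- The interpretation `A` satisfies all literals in the list `l` which are quantifier-free formulas
over its signature. -/
def Interpretation.SatisfiesLits (A : Interpretation.{u} L) (l : List (ℕ × Bool)) : Prop :=
  ∀ p ∈ l, ∀ ψ : Formula L, ψ.IsQF → ψ.code = p.1 → (A.Satisfies ψ ↔ p.2 = true)

/-- `W` decides which numbers are Gödel numbers of quantifier-free formulas. -/
def Signature.IsDecider (L : Signature) (W : ℕ → Bool) : Prop :=
  ∀ c, W c = true ↔ ∃ φ : Formula L, φ.IsQF ∧ φ.code = c

/-- This performs the separation: a mixed list is given to both theories, and each decider silently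
drops the literals that are not over its own signature. -/
theorem exists_code_eq_conjCode {W : ℕ → Bool} (hW : L.IsDecider W) {base : Formula L}
    (hbase : base.IsQF) (l : List (ℕ × Bool)) :
    ∃ φ : Formula L, φ.IsQF ∧ φ.code = conjCode W base.code l ∧
      ∀ A : Interpretation.{u} L, A.Satisfies φ ↔ A.Satisfies base ∧ A.SatisfiesLits l := by
  induction l generalizing base with
  | nil => exact ⟨base, hbase, rfl, fun A => by simp [Interpretation.SatisfiesLits]⟩
  | cons p l ih =>
    obtain ⟨c, b⟩ := p
    have hstep : ∃ base' : Formula L, base'.IsQF ∧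
        base'.code = (if W c = true then andCode (if b = true then c else negCode c) base.code
          else base.code) ∧ ∀ A : Interpretation.{u} L, A.Satisfies base' ↔ A.Satisfies base ∧
          ∀ ψ : Formula L, ψ.IsQF → ψ.code = c → (A.Satisfies ψ ↔ b = true) := by
      by_cases hc : W c = true
      · obtain ⟨ψ, hψ, rfl⟩ := (hW c).1 hc
        have huniq : ∀ A : Interpretation.{u} L, (∀ ψ' : Formula L, ψ'.IsQF →
            ψ'.code = ψ.code → (A.Satisfies ψ' ↔ b = true)) ↔ (A.Satisfies ψ ↔ b = true) :=
          fun A => ⟨fun h => h ψ hψ rfl, fun h ψ' _ h' => by rwa [Formula.code_injective h']⟩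
        rw [if_pos hc]
        cases b with
        | true =>
          refine ⟨.and ψ base, ⟨hψ, hbase⟩, rfl, fun A => ?_⟩
          rw [huniq, and_comm]
          simp [Interpretation.Satisfies, Formula.Realize]
        | false =>
          refine ⟨.and (.neg ψ) base, ⟨hψ, hbase⟩, rfl, fun A => ?_⟩
          rw [huniq, and_comm]
          simp [Interpretation.Satisfies, Formula.Realize]
      · rw [if_neg hc]
        exact ⟨base, hbase, rfl, fun A => (and_iff_left fun ψ hψ h =>
          absurd ((hW c).2 ⟨ψ, hψ, h⟩) hc).symm⟩
    obtain ⟨base', hb, hbc, hb'⟩ := hstep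
    obtain ⟨φ, hφ, hφc, hφ'⟩ := ih hb
    refine ⟨φ, hφ, by rw [hφc, hbc]; rfl, fun A => ?_⟩
    rw [hφ', hb']
    simp only [Interpretation.SatisfiesLits, List.forall_mem_cons, and_assoc]

/-- The Gödel number of the equation `x = x`. -/
def reflCode (s : ℕ) : ℕ := eqCode s (varCode s 0) (varCode s 0)

/-- The tautology x = x serves as the empty conjunction, since the language has no constant for
truth. -/
theorem exists_code_eq_conjCode_refl {W : ℕ → Bool} (hW : L.IsDecider W) {s : ℕ}
    (hs : s ∈ L.sorts) (l : List (ℕ × Bool)) :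
    ∃ φ : Formula L, φ.IsQF ∧ φ.code = conjCode W (reflCode s) l ∧
      ∀ A : Interpretation.{u} L, A.Satisfies φ ↔ A.SatisfiesLits l := by
  obtain ⟨φ, hφ, hc, h⟩ := exists_code_eq_conjCode.{u} hW
    (base := .flatEq s hs 0 0) trivial l
  exact ⟨φ, hφ, hc, fun A => (h A).trans (and_iff_right rfl)⟩

/-- All valuations of the numbers in a list. -/
def valuations (l : List ℕ) : List (List (ℕ × Bool)) :=
  l.foldl (fun acc a => acc.flatMap fun τ => [(a, true) :: τ, (a, false) :: τ]) [[]]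

theorem exists_mem_valuations (l : List ℕ) (θ : ℕ → Bool) :
    ∃ τ ∈ valuations l, ∀ p : ℕ × Bool, p ∈ τ ↔ p.1 ∈ l ∧ p.2 = θ p.1 := by
  -- Generalised over the accumulator: any partial valuation already present can be extended by θ on
  -- the remaining entries.
  have : ∀ (l : List ℕ) (acc : List (List (ℕ × Bool))), ∀ τ₀ ∈ acc,
      ∃ τ ∈ l.foldl (fun acc a => acc.flatMap fun τ => [(a, true) :: τ, (a, false) :: τ]) acc,
        ∀ p : ℕ × Bool, p ∈ τ ↔ p ∈ τ₀ ∨ p.1 ∈ l ∧ p.2 = θ p.1 := by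
    intro l
    induction l with
    | nil => exact fun acc τ₀ h => ⟨τ₀, h, by simp⟩
    | cons a l ih =>
      intro acc τ₀ h
      obtain ⟨τ, hτ, hp⟩ := ih (acc.flatMap fun τ => [(a, true) :: τ, (a, false) :: τ])
        ((a, θ a) :: τ₀) (List.mem_flatMap.2 ⟨τ₀, h, by cases θ a <;> simp⟩)
      refine ⟨τ, hτ, fun ⟨c, b⟩ => ?_⟩
      rw [hp]
      simp only [List.mem_cons, Prod.mk.injEq]
      constructor
      · rintro ((⟨rfl, rfl⟩ | h) | h)
        exacts [Or.inr ⟨Or.inl rfl, rfl⟩, Or.inl h, Or.inr ⟨Or.inr h.1, h.2⟩]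
      · rintro (h | ⟨rfl | h, rfl⟩)
        exacts [Or.inl (Or.inr h), Or.inl (Or.inl ⟨rfl, rfl⟩), Or.inr ⟨h, rfl⟩]
  simpa [valuations] using this l [[]] [] (by simp)

theorem exists_mem_of_mem_valuations {l : List ℕ} {τ : List (ℕ × Bool)} (h : τ ∈ valuations l)
    {a : ℕ} (ha : a ∈ l) : ∃ b, (a, b) ∈ τ := by
  -- The first conjunct records that later rounds only extend a valuation, so a value once assigned
  -- survives to the end.
  have : ∀ (l : List ℕ) (acc : List (List (ℕ × Bool))),
      τ ∈ l.foldl (fun acc a => acc.flatMap fun τ => [(a, true) :: τ, (a, false) :: τ]) acc →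
        (∃ τ₀ ∈ acc, τ₀ ⊆ τ) ∧ ∀ a ∈ l, ∃ b, (a, b) ∈ τ := by
    intro l
    induction l with
    | nil => exact fun acc h => ⟨⟨τ, h, List.Subset.refl _⟩, by simp⟩
    | cons a l ih =>
      intro acc h
      obtain ⟨⟨τ₀, h₀, hsub⟩, hl⟩ := ih _ h
      obtain ⟨τ₁, h₁, h₂⟩ := List.mem_flatMap.1 h₀
      obtain ⟨b, rfl⟩ : ∃ b, τ₀ = (a, b) :: τ₁ := by
        rcases List.mem_cons.1 h₂ with rfl | h₂
        · exact ⟨true, rfl⟩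
        · exact ⟨false, by simpa using h₂⟩
      refine ⟨⟨τ₁, h₁, fun x hx => hsub (List.mem_cons_of_mem _ hx)⟩, ?_⟩
      rw [List.forall_mem_cons]
      exact ⟨⟨b, hsub List.mem_cons_self⟩, hl⟩
  exact (this l [[]] h).2 a ha

/-- The flat atoms for the formula with Gödel number `n`: all equations between variables naming
terms, and the flattened predicates. -/
noncomputable def flatAtoms (S : Finset ℕ) (n : ℕ) : List ℕ :=
  (S.toList.flatMap fun s => (List.range (n + 1)).flatMap fun c =>
    (List.range (n + 1)).map fun c' => eqCode s (varCode s c) (varCode s c')) ++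
  -- Also applied to numbers that do not code predicates; the entries this adds are either dropped
  -- by `conjCode` or are further atoms to guess, and both are harmless.
  (List.range (n + 1)).map flatApp

/-- The definitions of the variables naming the compound terms with Gödel number at most `n`. -/
noncomputable def flatDefs (L : Signature) (n : ℕ) : List (ℕ × Bool) :=
  (List.range (n + 1)).flatMap fun c =>
    if c.unpair.1 = 1 ∧ (termSort L c).isSome = true then [(flatDef c, true)] else []

/-- Literals stating that there are at least `v i` elements of sort `e i`, by means of variables of
index at least `N`. -/
def distinctLits {k : ℕ} (e : Fin k → ℕ) (N : ℕ) (v : Fin k → ℕ) : List (ℕ × Bool) :=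
  (List.finRange k).flatMap fun i => (List.range (v i)).flatMap fun j =>
    (List.range j).map fun j' =>
      (eqCode (e i) (varCode (e i) (N + j)) (varCode (e i) (N + j')), false)

/-- The truth value of an atom according to a list of flat literals. -/
def litTrue (τ : List (ℕ × Bool)) (c : ℕ) : Bool := τ.any fun p => decide (p = (flatAtom c, true))

theorem litTrue_iff {τ : List (ℕ × Bool)} {c : ℕ} :
    litTrue τ c = true ↔ (flatAtom c, true) ∈ τ := by
  simp [litTrue]

theorem mem_flatAtoms_flatEq {s n c c' : ℕ} (hs : s ∈ L.sorts) (hs' : s ∈ L'.sorts) (hc : c ≤ n) (hc' : c' ≤ n) :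
    (Formula.flatEq (L := L') s hs' c c').code ∈ flatAtoms L.sorts n := by
  refine List.mem_append_left _ ?_
  simp only [List.mem_flatMap, List.mem_map, List.mem_range, Finset.mem_toList]
  exact ⟨s, hs, c, by omega, c', by omega, rfl⟩

theorem mem_flatAtoms_flatApp {S : Finset ℕ} {n c : ℕ} (hc : c ≤ n) :
    flatApp c ∈ flatAtoms S n :=
  List.mem_append_right _ (List.mem_map.2 ⟨c, by simpa using Nat.lt_succ_of_le hc, rfl⟩)

theorem mem_flatDefs_iff {n : ℕ} {p : ℕ × Bool} :
    p ∈ flatDefs L n ↔ ∃ (f : FunSym) (hf : f ∈ L.funs)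
      (args : (i : Fin f.dom.length) → Term L (f.dom.get i)),
      (Term.app f hf args).code ≤ n ∧ p = (flatDef (Term.app f hf args).code, true) := by
  simp only [flatDefs, List.mem_flatMap, List.mem_range]
  constructor
  · rintro ⟨c, hc, hp⟩
    split_ifs at hp with h
    · obtain ⟨h1, h2⟩ := h
      obtain ⟨s, hs⟩ := Option.isSome_iff_exists.1 h2
      obtain ⟨t, rfl⟩ := termSort_eq_some_iff.1 hs
      cases t with
      | var s hs i => simp [Term.code] at h1
      | app f hf args => exact ⟨f, hf, args, by omega, by simpa using hp⟩
    · simp at hp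
  · rintro ⟨f, hf, args, hc, rfl⟩
    refine ⟨_, Nat.lt_succ_of_le hc, ?_⟩
    rw [if_pos ⟨by simp [Term.code], by simp⟩]
    exact List.mem_singleton_self _

/-! ## The decision procedure -/

/-- The decision procedure for the union of two theories. Here `W₁` and `W₂` decide which numbers
are Gödel numbers of quantifier-free formulas, `D` decides satisfiability for the second theory,
and `m` computes the minimal sizes of models for the first one. -/
noncomputable def decideUnion (L : Signature) (W₁ W₂ D : ℕ → Bool) (s₁ s₂ : ℕ) {k : ℕ}
    (e : Fin k → ℕ) (m : ℕ → List (Fin k → ℕ)) (n : ℕ) : Bool :=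
  (valuations (flatAtoms L.sorts n)).any fun τ =>
    -- Checks at once that n codes a quantifier-free formula and that the guess makes it true.
    decide (evalCode L (litTrue τ) n = some true) &&
    (m (conjCode W₁ (reflCode s₁) (τ ++ flatDefs L n))).any fun v =>
      D (andCode (conjCode W₂ (reflCode s₂) (τ ++ flatDefs L n))
        (conjCode W₂ (reflCode s₂)
          -- Indices above the code of Γ₂ do not occur in Γ₂, so the variables counting elements are
          -- fresh.
          (distinctLits e (conjCode W₂ (reflCode s₂) (τ ++ flatDefs L n) + 1) v)))

theorem computable_conjCode {α : Type*} [Primcodable α] {W : ℕ → Bool} (hW : Computable W)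
    (base : ℕ) {f : α → List (ℕ × Bool)} (hf : Computable f) :
    Computable fun a => conjCode W base (f a) := by
  have h1 : Computable fun q : α × ℕ × ℕ × Bool => q.2.2.1 :=
    Computable.fst.comp (Computable.snd.comp Computable.snd)
  have h2 : Computable fun q : α × ℕ × ℕ × Bool => q.2.2.2 :=
    Computable.snd.comp (Computable.snd.comp Computable.snd)
  have h3 : Computable fun q : α × ℕ × ℕ × Bool => q.2.1 :=
    Computable.fst.comp Computable.snd
  exact computable_list_foldl (h := fun _ (acc : ℕ) (p : ℕ × Bool) => if W p.1 = true then
    andCode (if p.2 = true then p.1 else negCode p.1) acc else acc) hf (Computable.const base)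
    (computable_ite (computable_bool_eq_true (hW.comp h1))
      (computable_andCode (computable_ite (computable_bool_eq_true h2) h1
        (computable_negCode.comp h1)) h3) h3)

theorem computable_valuations : Computable valuations := by
  have h : ∀ b : Bool, Computable fun q : (List ℕ × List (List (ℕ × Bool)) × ℕ) ×
      List (ℕ × Bool) => (q.1.2.2, b) :: q.2 := fun b =>
    Computable.list_cons.comp
      ((Computable.snd.comp (Computable.snd.comp Computable.fst)).pair (Computable.const b))
      Computable.snd
  refine computable_list_foldl (h := fun (_ : List ℕ) (acc : List (List (ℕ × Bool))) (a : ℕ) =>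
    acc.flatMap fun τ => [(a, true) :: τ, (a, false) :: τ]) Computable.id (Computable.const [[]])
    (computable_list_flatMap (Computable.fst.comp Computable.snd) ?_)
  exact Computable.list_cons.comp (h true)
    (Computable.list_cons.comp (h false) (Computable.const []))

theorem computable_range {α : Type*} [Primcodable α] {f : α → ℕ} (hf : Computable f) :
    Computable fun a => List.range (f a) :=
  Primrec.list_range.to_comp.comp hf

theorem computable_flatAtoms (S : Finset ℕ) : Computable (flatAtoms S) := by
  have hn : Computable fun n : ℕ => List.range (n + 1) := computable_range Computable.succ
  refine Computable.list_append.comp (computable_list_flatMap (Computable.const _)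
    (computable_list_flatMap (hn.comp Computable.fst)
      (computable_list_map (hn.comp (Computable.fst.comp Computable.fst)) ?_)))
    (computable_list_map hn (computable_flatApp.comp Computable.snd))
  have hs : Computable fun q : ((ℕ × ℕ) × ℕ) × ℕ => q.1.1.2 :=
    Computable.snd.comp (Computable.fst.comp Computable.fst)
  exact computable_eqCode hs (computable_varCode hs (Computable.snd.comp Computable.fst))
    (computable_varCode hs Computable.snd)

theorem computable_flatDefs (h : Computable (termSort L)) : Computable (flatDefs L) := by
  refine computable_list_flatMap (computable_range Computable.succ) ?_
  have hs : Computable fun o : Option ℕ => o.isSome := Primrec.option_isSome.to_comp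
  exact computable_ite (computablePred_and
    (computablePred_eq (computable_unpair_fst Computable.snd) (Computable.const 1))
    (computable_bool_eq_true (hs.comp (h.comp Computable.snd))))
    (Computable.list_cons.comp
      ((computable_flatDef.comp Computable.snd).pair (Computable.const true))
      (Computable.const [])) (Computable.const [])

theorem computable_distinctLits {α : Type*} [Primcodable α] {k : ℕ} (e : Fin k → ℕ)
    {f : α → ℕ} {g : α → Fin k → ℕ} (hf : Computable f) (hg : Computable g) :
    Computable fun a => distinctLits e (f a) (g a) := by
  have hv : Computable fun q : α × Fin k => g q.1 q.2 :=
    Computable.fin_app.comp (hg.comp Computable.fst) Computable.snd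
  refine computable_list_flatMap (Computable.const _) (computable_list_flatMap
    (computable_range hv) (computable_list_map (computable_range Computable.snd) ?_))
  have hi : Computable fun q : ((α × Fin k) × ℕ) × ℕ => e q.1.1.2 :=
    (Primrec.dom_finite e).to_comp.comp
      (Computable.snd.comp (Computable.fst.comp Computable.fst))
  have hN : Computable fun q : ((α × Fin k) × ℕ) × ℕ => f q.1.1.1 :=
    hf.comp (Computable.fst.comp (Computable.fst.comp Computable.fst))
  exact (computable_eqCode hi
    (computable_varCode hi (Primrec.nat_add.to_comp.comp hN (Computable.snd.comp Computable.fst)))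
    (computable_varCode hi (Primrec.nat_add.to_comp.comp hN Computable.snd))).pair
      (Computable.const false)

theorem computable_litTrue : Computable₂ litTrue :=
  computable_list_any Computable.fst
    (computablePred_eq Computable.snd
      ((computable_flatAtom.comp (Computable.snd.comp Computable.fst)).pair
        (Computable.const true))).decide

theorem computable_decideUnion {W₁ W₂ D F R : ℕ → Bool} (hW₁ : Computable W₁)
    (hW₂ : Computable W₂) (hD : Computable D) (hF : Computable F)
    (hF' : ∀ f : FunSym, F f.code = true ↔ f ∈ L.funs) (hR : Computable R)
    (hR' : ∀ P : PredSym, R P.code = true ↔ P ∈ L.preds) (s₁ s₂ : ℕ) {k : ℕ} (e : Fin k → ℕ)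
    {m : ℕ → List (Fin k → ℕ)} (hm : Computable m) :
    Computable (decideUnion L W₁ W₂ D s₁ s₂ e m) := by
  have hτ : Computable (termSort L) := computable_termSort hF hF'
  have hlits : Computable fun q : ℕ × List (ℕ × Bool) => q.2 ++ flatDefs L q.1 :=
    Computable.list_append.comp Computable.snd ((computable_flatDefs hτ).comp Computable.fst)
  have hg := computable_conjCode hW₂ (reflCode s₂) hlits
  refine computable_list_any (computable_valuations.comp (computable_flatAtoms L.sorts))
    (Primrec.and.to_comp.comp (computablePred_eq
      ((computable_evalCode hτ hR hR' computable_litTrue).comp Computable.snd Computable.fst)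
      (Computable.const (some true))).decide
      (computable_list_any (hm.comp (computable_conjCode hW₁ (reflCode s₁) hlits)) ?_))
  have hg' := hg.comp (Computable.fst (α := ℕ × List (ℕ × Bool)) (β := Fin k → ℕ))
  exact hD.comp (computable_andCode hg' (computable_conjCode hW₂ (reflCode s₂)
    (computable_distinctLits e (Computable.succ.comp hg') Computable.snd)))

/-! ## Flattening -/

/-- Equations between variables of index at most `n`, and predicate and function symbols applied to
such variables. -/
inductive Formula.IsFlat (n : ℕ) : Formula L → Prop
  | flatEq (s : ℕ) (hs : s ∈ L.sorts) (i j : ℕ) (hi : i ≤ n) (hj : j ≤ n) :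
      IsFlat n (Formula.flatEq s hs i j)
  | flatRel (P : PredSym) (hP : P ∈ L.preds) (a : Fin P.dom.length → ℕ) (ha : ∀ i, a i ≤ n) :
      IsFlat n (Formula.flatRel P hP a)
  | flatFun (f : FunSym) (hf : f ∈ L.funs) (a : Fin f.dom.length → ℕ) (j : ℕ)
      (ha : ∀ i, a i ≤ n) (hj : j ≤ n) : IsFlat n (Formula.flatFun f hf a j)

theorem Formula.IsFlat.isQF {n : ℕ} {ψ : Formula L} (h : ψ.IsFlat n) : ψ.IsQF := by
  cases h <;> trivial

theorem Formula.IsFlat.le_of_mem_freeVars {n : ℕ} {ψ : Formula L} (h : ψ.IsFlat n) {v : ℕ × ℕ}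
    (hv : v ∈ ψ.freeVars) : v.2 ≤ n := by
  cases h with
  | flatEq s hs i j hi hj =>
    rcases hv with rfl | rfl
    exacts [hi, hj]
  | flatRel P hP a ha =>
    obtain ⟨i, rfl⟩ := Set.mem_iUnion.1 hv
    exact ha i
  | flatFun f hf a j ha hj =>
    rcases hv with hv | rfl
    · obtain ⟨i, rfl⟩ := Set.mem_iUnion.1 hv
      exact ha i
    · exact hj

/-- A flat formula has at most one symbol besides equality, so it is pure; flattening exists for
this purpose. -/
theorem Formula.IsFlat.exists_incl {n : ℕ} {ψ : Formula (L₁.union L₂)} (h : ψ.IsFlat n) :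
    (∃ ψ₁ : Formula L₁, ψ₁.IsFlat n ∧ ψ₁.incl (L₁.sub_union_left L₂) = ψ) ∨
      ∃ ψ₂ : Formula L₂, ψ₂.IsFlat n ∧ ψ₂.incl (L₁.sub_union_right L₂) = ψ := by
  cases h with
  | flatEq s hs i j hi hj =>
    exact (Finset.mem_union.1 hs).imp (fun h => ⟨_, .flatEq s h i j hi hj, rfl⟩)
      (fun h => ⟨_, .flatEq s h i j hi hj, rfl⟩)
  | flatRel P hP a ha =>
    exact hP.imp (fun h => ⟨_, .flatRel P h a ha, rfl⟩) (fun h => ⟨_, .flatRel P h a ha, rfl⟩)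
  | flatFun f hf a j ha hj =>
    exact hf.imp (fun h => ⟨_, .flatFun f h a j ha hj, rfl⟩)
      (fun h => ⟨_, .flatFun f h a j ha hj, rfl⟩)

/-- The values of the original variables, given those of the variables naming the terms. -/
def Assignment.unflatten {A : Structure.{u} L} (ν : Assignment A) : Assignment A :=
  -- An original variable is itself a term, and its name is the variable indexed by its code.
  fun s hs i => ν s hs (varCode s i)

/-- If the variables naming the terms satisfy their definitions, they have the values of these
terms. -/
theorem Term.eval_eq_of_flatFun {I : Interpretation.{u} L} {n : ℕ}
    (hI : ∀ (f : FunSym) (hf : f ∈ L.funs)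
      (args : (i : Fin f.dom.length) → Term L (f.dom.get i)), (Term.app f hf args).code ≤ n →
        I.Satisfies (Formula.flatFun f hf (fun i => (args i).code) (Term.app f hf args).code))
    {s : ℕ} (t : Term L s) (hs : s ∈ L.sorts) (ht : t.code ≤ n) :
    t.eval I.str I.asg.unflatten = I.asg s hs t.code := by
  induction t with
  | var s hs i => rfl
  | app f hf args ih =>
    refine Eq.trans ?_ (hI f hf args ht)
    simp only [Term.eval]
    congr 1
    funext i
    exact ih i _ ((Term.code_arg_lt f hf args i).le.trans ht)

/-- The definitions make each atom of φ equivalent to its flat version, and τ assigns a correct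
value to every flat atom; so the truth of φ is read off from τ alone. -/
theorem Formula.realize_iff_boolEval_litTrue {I : Interpretation.{u} L} {n : ℕ}
    {τ : List (ℕ × Bool)}
    (hdef : ∀ (f : FunSym) (hf : f ∈ L.funs)
      (args : (i : Fin f.dom.length) → Term L (f.dom.get i)), (Term.app f hf args).code ≤ n →
        I.Satisfies (Formula.flatFun f hf (fun i => (args i).code) (Term.app f hf args).code))
    (hτ : ∀ ψ : Formula L, ψ.IsFlat n → ∀ b, (ψ.code, b) ∈ τ → (I.Satisfies ψ ↔ b = true))
    (hmem : ∀ c ∈ flatAtoms L.sorts n, ∃ b, (c, b) ∈ τ) (φ : Formula L) (hφ : φ.IsQF)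
    (hn : φ.code ≤ n) :
    φ.Realize I.str I.asg.unflatten ↔
      φ.boolEval (litTrue τ) = true := by
  -- Because τ covers every such atom, absence of the positive literal means falsity and not mere
  -- lack of information.
  have key : ∀ ψ : Formula L, ψ.IsFlat n → ψ.code ∈ flatAtoms L.sorts n →
      (I.Satisfies ψ ↔ (ψ.code, true) ∈ τ) := by
    intro ψ hψ hc
    obtain ⟨b, hb⟩ := hmem _ hc
    constructor
    · intro h
      rwa [← (hτ ψ hψ b hb).1 h]
    · intro h
      exact (hτ ψ hψ true h).2 rfl
  induction φ with
  | eq s hs t t' =>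
    have ht : t.code ≤ n := le_trans (le_pair_of_le_right (le_pair_of_le_right
      (le_pair_of_le_left le_rfl))) hn
    have ht' : t'.code ≤ n := le_trans (le_pair_of_le_right (le_pair_of_le_right
      (le_pair_of_le_right le_rfl))) hn
    rw [Formula.Realize, Term.eval_eq_of_flatFun hdef t hs ht,
      Term.eval_eq_of_flatFun hdef t' hs ht', Formula.boolEval, litTrue_iff,
      ← Formula.code_flatEq s hs hs t t',
      ← key _ (.flatEq s hs _ _ ht ht') (mem_flatAtoms_flatEq hs hs ht ht')]
    rfl
  | rel P hP args =>
    have ht : ∀ i, (args i).code ≤ n := fun i =>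
      (Formula.code_rel_arg_lt P hP args i).le.trans hn
    have hc : (Formula.flatRel P hP fun i => (args i).code).code ∈ flatAtoms L.sorts n := by
      rw [Formula.code_flatRel P hP hP args, flatAtom, if_neg (by simp [Formula.code])]
      exact mem_flatAtoms_flatApp hn
    rw [Formula.boolEval, litTrue_iff, ← Formula.code_flatRel P hP hP args,
      ← key _ (.flatRel P hP _ ht) hc, Formula.Realize]
    rw [show (fun i => (args i).eval I.str _) = _ from
      funext fun i => Term.eval_eq_of_flatFun hdef (args i) (L.get_dom_pred_mem hP i) (ht i)]
    rfl
  | neg φ ih =>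
    have h := ih hφ (le_trans (le_pair_of_le_right le_rfl) hn)
    simp only [Formula.Realize, Formula.boolEval, h, Bool.not_eq_true']
    simp
  | and φ ψ ih₁ ih₂ =>
    have h₁ := ih₁ hφ.1 (le_trans (le_pair_of_le_right (le_pair_of_le_left le_rfl)) hn)
    have h₂ := ih₂ hφ.2 (le_trans (le_pair_of_le_right (le_pair_of_le_right le_rfl)) hn)
    simp only [Formula.Realize, Formula.boolEval, h₁, h₂, Bool.and_eq_true]
  | all s hs i φ ih => exact hφ.elim

/-- Distinct terms have distinct codes, so all names can receive their intended values
simultaneously. -/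
theorem exists_assignment_eq_eval (I : Interpretation.{u} L) :
    ∃ ν : Assignment I.str, ∀ (s : ℕ) (hs : s ∈ L.sorts) (t : Term L s),
      ν s hs t.code = t.eval I.str I.asg := by
  classical
  refine ⟨fun s hs c => if h : ∃ t : Term L s, t.code = c then h.choose.eval I.str I.asg
    else I.asg s hs 0, fun s hs t => ?_⟩
  have h : ∃ t' : Term L s, t'.code = t.code := ⟨t, rfl⟩
  simp only [dif_pos h]
  rw [Term.code_injective h.choose_spec]

/-- Every interpretation gives rise to values of the variables naming the terms, and to truth values
of the flat atoms. -/
theorem Interpretation.exists_valuation (I : Interpretation.{u} L) (n : ℕ) :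
    ∃ ν : Assignment I.str, ∃ τ ∈ valuations (flatAtoms L.sorts n),
      (⟨I.str, ν⟩ : Interpretation L).SatisfiesLits (τ ++ flatDefs L n) ∧
      ∀ φ : Formula L, φ.IsQF → φ.code ≤ n →
        (φ.boolEval (litTrue τ) = true ↔ I.Satisfies φ) := by
  classical
  obtain ⟨ν, hν⟩ := exists_assignment_eq_eval I
  obtain ⟨τ, hτ, hmem⟩ := exists_mem_valuations (flatAtoms L.sorts n) fun c =>
    decide (∃ ψ : Formula L, ψ.code = c ∧ ψ.Realize I.str ν)
  have hdec : ∀ ψ : Formula L, (∃ ψ' : Formula L, ψ'.code = ψ.code ∧ ψ'.Realize I.str ν) ↔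
      ψ.Realize I.str ν := fun ψ =>
    ⟨fun ⟨ψ', h, h'⟩ => by rwa [← Formula.code_injective h], fun h => ⟨ψ, rfl, h⟩⟩
  have hdef : ∀ (f : FunSym) (hf : f ∈ L.funs)
      (args : (i : Fin f.dom.length) → Term L (f.dom.get i)),
      (Formula.flatFun f hf (fun i => (args i).code) (Term.app f hf args).code).Realize
        I.str ν := by
    intro f hf args
    simp only [Formula.flatFun, Formula.Realize, Term.eval, hν]
  have hlits : (⟨I.str, ν⟩ : Interpretation L).SatisfiesLits (τ ++ flatDefs L n) := by
    rintro ⟨c, b⟩ hp ψ hψ rfl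
    rcases List.mem_append.1 hp with hp | hp
    · obtain ⟨-, hb⟩ := (hmem _).1 hp
      simp only at hb
      rw [hb, decide_eq_true_eq, hdec]
      rfl
    · obtain ⟨f, hf, args, -, he⟩ := mem_flatDefs_iff.1 hp
      obtain ⟨hc, rfl⟩ := Prod.mk.inj he
      rw [← Formula.code_flatFun f hf hf args] at hc
      obtain rfl := Formula.code_injective hc
      exact iff_of_true (hdef f hf args) rfl
  refine ⟨ν, τ, hτ, hlits, fun φ hφ hn => ?_⟩
  rw [← Formula.realize_iff_boolEval_litTrue (I := ⟨I.str, ν⟩) (fun f hf args _ => hdef f hf args)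
    (fun ψ hψ b hb => hlits _ (List.mem_append_left _ hb) ψ hψ.isQF rfl)
    (fun c hc => exists_mem_of_mem_valuations hτ hc) φ hφ hn]
  exact φ.realize_congr fun s hs i _ => hν s hs (.var s hs i)

theorem Interpretation.SatisfiesLits.reduct (h : L.Sub L') {A : Structure.{u} L'}
    {ν : Assignment A} {l : List (ℕ × Bool)}
    (hA : (⟨A, ν⟩ : Interpretation L').SatisfiesLits l) :
    (⟨A.reduct h, ν.reduct h⟩ : Interpretation L).SatisfiesLits l := by
  intro p hp ψ hψ hc
  rw [← hA p hp (ψ.incl h) ((ψ.isQF_incl h).2 hψ) ((ψ.code_incl h).trans hc)]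
  exact (ψ.realize_incl h A ν).symm

theorem Interpretation.satisfiesLits_distinctLits_iff {A : Interpretation.{u} L} {k : ℕ}
    {e : Fin k → ℕ} (he : ∀ i, e i ∈ L.sorts) {N : ℕ} {v : Fin k → ℕ} :
    A.SatisfiesLits (distinctLits e N v) ↔ ∀ i, ∀ j < v i, ∀ j' < j,
      A.asg (e i) (he i) (N + j) ≠ A.asg (e i) (he i) (N + j') := by
  constructor
  · intro h i j hj j' hj'
    have := h (eqCode (e i) (varCode (e i) (N + j)) (varCode (e i) (N + j')), false) (by
      simp only [distinctLits, List.mem_flatMap, List.mem_map, List.mem_range]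
      exact ⟨i, List.mem_finRange i, j, hj, j', hj', rfl⟩)
      (.flatEq (e i) (he i) (N + j) (N + j')) trivial rfl
    simp only [Bool.false_eq_true, iff_false] at this
    exact this
  · intro h p hp ψ hψ hc
    simp only [distinctLits, List.mem_flatMap, List.mem_map, List.mem_range] at hp
    obtain ⟨i, -, j, hj, j', hj', rfl⟩ := hp
    obtain rfl : ψ = .flatEq (e i) (he i) (N + j) (N + j') := Formula.code_injective hc
    exact iff_of_false (h i j hj j' hj') Bool.false_ne_true

/-! ## Correctness of the decision procedure -/

section Correctness

variable {T₁ : Theory L₁} {T₂ : Theory L₂} {W₁ W₂ D : ℕ → Bool} {s₁ s₂ : ℕ}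
  {m : ℕ → List (Fin (L₁.sorts ∩ L₂.sorts).card → ℕ)}

/-- The sorts shared by two signatures, in increasing order. -/
def sharedSort (L₁ L₂ : Signature) (i : Fin (L₁.sorts ∩ L₂.sorts).card) : ℕ :=
  (L₁.sorts ∩ L₂.sorts).orderEmbOfFin rfl i

theorem sharedSort_mem (i : Fin (L₁.sorts ∩ L₂.sorts).card) :
    sharedSort L₁ L₂ i ∈ L₁.sorts ∩ L₂.sorts :=
  Finset.orderEmbOfFin_mem _ _ _

theorem sharedSort_injective : Function.Injective (sharedSort L₁ L₂) :=
  ((L₁.sorts ∩ L₂.sorts).orderEmbOfFin rfl).injective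

theorem exists_sharedSort_eq {s : ℕ} (hs : s ∈ L₁.sorts ∩ L₂.sorts) :
    ∃ i, sharedSort L₁ L₂ i = s := by
  have : s ∈ Set.range ((L₁.sorts ∩ L₂.sorts).orderEmbOfFin rfl) := by
    rw [Finset.range_orderEmbOfFin]
    exact hs
  exact this

theorem natCast_le_mk_of_pairwise_ne {α : Type u} {n : ℕ} {a : ℕ → α}
    (h : ∀ j < n, ∀ j' < j, a j ≠ a j') : (n : Cardinal.{u}) ≤ Cardinal.mk α := by
  have hinj : Function.Injective fun j : Fin n => a j := by
    intro j j' hj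
    rcases lt_trichotomy (j : ℕ) j' with hlt | heq | hlt
    · exact absurd hj.symm (h _ j'.2 _ hlt)
    · exact Fin.ext heq
    · exact absurd hj (h _ j.2 _ hlt)
  simpa using Cardinal.lift_mk_le'.2 ⟨⟨_, hinj⟩⟩

theorem exists_pairwise_ne_of_natCast_le {α : Type u} [Nonempty α] {n : ℕ}
    (h : (n : Cardinal.{u}) ≤ Cardinal.mk α) :
    ∃ a : ℕ → α, ∀ j < n, ∀ j' < j, a j ≠ a j' := by
  have h' : Cardinal.lift.{u} (Cardinal.mk (Fin n)) ≤ Cardinal.lift.{0} (Cardinal.mk α) := by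
    simpa using h
  obtain ⟨F⟩ := Cardinal.lift_mk_le'.1 h'
  refine ⟨fun j => if hj : j < n then F ⟨j, hj⟩ else Classical.arbitrary α,
    fun j hj j' hj' he => ?_⟩
  simp only [dif_pos hj, dif_pos (hj'.trans hj)] at he
  have := F.injective he
  simp only [Fin.mk.injEq] at this
  omega

/-- Soundness. The accepted tuple v is the exact size of a T₁-model of Γ₁ and a lower bound for the
T₂-model of Γ₂, which is what the combination theorem needs. -/
theorem satisfiable_of_decideUnion (hdisj : L₁.IsDisjoint L₂)
    (hfs : T₁.FinitelySmooth.{u} (L₁.sorts ∩ L₂.sorts))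
    (hW₁ : L₁.IsDecider W₁) (hW₂ : L₂.IsDecider W₂) (hs₁ : s₁ ∈ L₁.sorts) (hs₂ : s₂ ∈ L₂.sorts)
    (hD : ∀ n, D n = true ↔ ∃ φ : Formula L₂, φ.IsQF ∧ φ.code = n ∧ T₂.Satisfiable.{u} φ)
    (hm : ∀ φ : Formula L₁, φ.IsQF → Theory.minmods.{u} T₁ (L₁.sorts ∩ L₂.sorts) φ =
      {k | ∃ v ∈ m φ.code, k = fun i => (v i : Cardinal.{u})}) {n : ℕ}
    (h : decideUnion (L₁.union L₂) W₁ W₂ D s₁ s₂ (sharedSort L₁ L₂) m n = true) :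
    ∃ φ : Formula (L₁.union L₂), φ.IsQF ∧ φ.code = n ∧ (T₁.union T₂).Satisfiable.{u} φ := by
  simp only [decideUnion, List.any_eq_true, Bool.and_eq_true, decide_eq_true_eq] at h
  obtain ⟨τ, hτ, hev, v, hv, hDv⟩ := h
  obtain ⟨φ, hφ, rfl, hφτ⟩ := evalCode_eq_some_iff.1 hev
  set l := τ ++ flatDefs (L₁.union L₂) φ.code with hl
  obtain ⟨Γ₁, hΓ₁, hΓ₁c, hΓ₁s⟩ := exists_code_eq_conjCode_refl.{u} hW₁ hs₁ l
  obtain ⟨Γ₂, hΓ₂, hΓ₂c, hΓ₂s⟩ := exists_code_eq_conjCode_refl.{u} hW₂ hs₂ l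
  rw [← hΓ₁c] at hv
  rw [← hΓ₂c] at hDv
  obtain ⟨Δ, hΔ, hΔc, hΔs⟩ := exists_code_eq_conjCode_refl.{u} hW₂ hs₂
    (distinctLits (sharedSort L₁ L₂) (Γ₂.code + 1) v)
  rw [← hΔc] at hDv
  obtain ⟨χ, -, hχc, B, hBT, hBχ⟩ := (hD _).1 hDv
  obtain rfl : χ = .and Γ₂ Δ := Formula.code_injective hχc
  have hmin : (fun i => (v i : Cardinal.{u})) ∈
      Theory.minmods.{u} T₁ (L₁.sorts ∩ L₂.sorts) Γ₁ := by
    rw [hm Γ₁ hΓ₁]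
    exact ⟨v, hv, rfl⟩
  rw [Theory.minmods, Set.mem_ofPred_eq] at hmin
  obtain ⟨A, hAT, hAΓ, hAv⟩ := hmin.prop
  have hAc : ∀ i, A.card (sharedSort L₁ L₂ i) = v i := fun i => congrFun hAv i
  have hBc := (Interpretation.satisfiesLits_distinctLits_iff
    (fun i => (Finset.mem_inter.1 (sharedSort_mem i)).2)).1 ((hΔs B).1 hBχ.2)
  obtain ⟨I, A', B', hI, hA', hB', hIA, hIB⟩ := exists_amalgam_of_finitelySmooth hdisj
    (T₂ := T₂) hfs (φ₂ := Γ₂) hΓ₁ A B hAT hAΓ hBT hBχ.1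
    (fun s hs => by
      obtain ⟨i, rfl⟩ := exists_sharedSort_eq hs
      rw [hAc]
      exact Cardinal.natCast_lt_aleph0)
    (fun s hs => by
      obtain ⟨i, rfl⟩ := exists_sharedSort_eq hs
      rw [hAc]
      exact natCast_le_mk_of_pairwise_ne
        (a := fun j => B.asg _ (Finset.mem_inter.1 (sharedSort_mem i)).2 (Γ₂.code + 1 + j))
        (hBc i))
    φ.code
    -- τ gives a value to every equation between variables of index at most `φ.code`; over a shared
    -- sort the resulting literal occurs in both Γ₁ and Γ₂.
    (fun A B hA hB s h₁ h₂ c hc c' hc' => by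
      have hs : s ∈ (L₁.union L₂).sorts := Finset.mem_union_left _ h₁
      obtain ⟨b, hb⟩ := exists_mem_of_mem_valuations hτ
        (mem_flatAtoms_flatEq (L' := L₁) hs h₁ hc hc')
      have hA' := (hΓ₁s A).1 hA _ (List.mem_append_left _ hb) (.flatEq s h₁ c c') trivial rfl
      have hB' := (hΓ₂s B).1 hB _ (List.mem_append_left _ hb) (.flatEq s h₂ c c') trivial rfl
      exact hA'.trans hB'.symm)
  -- Each flat literal is pure, so its truth in the amalgam is inherited from `A'` or from `B'`.
  have hflat : ∀ ψ : Formula (L₁.union L₂), ψ.IsFlat φ.code → ∀ b, (ψ.code, b) ∈ l →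
      (I.Satisfies ψ ↔ b = true) := by
    intro ψ hψ b hb
    rcases hψ.exists_incl with ⟨ψ, h, rfl⟩ | ⟨ψ, h, rfl⟩
    · rw [hIA ψ fun v hv => h.le_of_mem_freeVars hv]
      exact (hΓ₁s A').1 hA' _ hb ψ h.isQF (ψ.code_incl _).symm
    · rw [hIB ψ fun v hv => h.le_of_mem_freeVars hv]
      exact (hΓ₂s B').1 hB' _ hb ψ h.isQF (ψ.code_incl _).symm
  have hφI := Formula.realize_iff_boolEval_litTrue (I := I) (n := φ.code) (τ := τ)
    (fun f hf args hn => (hflat _ (.flatFun f hf _ _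
        (fun i => (Term.code_arg_lt f hf args i).le.trans hn) hn) true
      (List.mem_append_right _ (mem_flatDefs_iff.2 ⟨f, hf, args, hn, by
        rw [Formula.code_flatFun f hf hf args]⟩))).2 rfl)
    (fun ψ hψ b hb => hflat ψ hψ b (List.mem_append_left _ hb))
    (fun c hc => exists_mem_of_mem_valuations hτ hc) φ hφ le_rfl
  exact ⟨φ, hφ, rfl, ⟨I.str, I.asg.unflatten⟩,
    Interpretation.models_congr_asg I.asg _ hI, hφI.2 hφτ⟩

/-- Completeness. The given model supplies both the guess τ and, through its two reducts, a minimal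
tuple v together with enough elements to realise it. -/
theorem decideUnion_of_satisfiable
    (hW₁ : L₁.IsDecider W₁) (hW₂ : L₂.IsDecider W₂) (hs₁ : s₁ ∈ L₁.sorts) (hs₂ : s₂ ∈ L₂.sorts)
    (hD : ∀ n, D n = true ↔ ∃ φ : Formula L₂, φ.IsQF ∧ φ.code = n ∧ T₂.Satisfiable.{u} φ)
    (hm : ∀ φ : Formula L₁, φ.IsQF → Theory.minmods.{u} T₁ (L₁.sorts ∩ L₂.sorts) φ =
      {k | ∃ v ∈ m φ.code, k = fun i => (v i : Cardinal.{u})})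
    {φ : Formula (L₁.union L₂)} (hφ : φ.IsQF) (h : (T₁.union T₂).Satisfiable.{u} φ) :
    decideUnion (L₁.union L₂) W₁ W₂ D s₁ s₂ (sharedSort L₁ L₂) m φ.code = true := by
  classical
  obtain ⟨I, hI, hIφ⟩ := h
  obtain ⟨ν, τ, hτ, hlits, hev⟩ := I.exists_valuation φ.code
  obtain ⟨hI₁, hI₂⟩ := (Theory.models_union_iff I.str ν).1
    (Interpretation.models_congr_asg I.asg ν hI)
  simp only [decideUnion, List.any_eq_true, Bool.and_eq_true, decide_eq_true_eq]
  refine ⟨τ, hτ, evalCode_eq_some_iff.2 ⟨φ, hφ, rfl, (hev φ hφ le_rfl).2 hIφ⟩, ?_⟩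
  set l := τ ++ flatDefs (L₁.union L₂) φ.code with hl
  obtain ⟨Γ₁, hΓ₁, hΓ₁c, hΓ₁s⟩ := exists_code_eq_conjCode_refl.{u} hW₁ hs₁ l
  obtain ⟨Γ₂, hΓ₂, hΓ₂c, hΓ₂s⟩ := exists_code_eq_conjCode_refl.{u} hW₂ hs₂ l
  rw [← hΓ₁c, ← hΓ₂c]
  let A : Interpretation.{u} L₁ := ⟨I.str.reduct (L₁.sub_union_left L₂), ν.reduct _⟩
  -- Tuples of cardinals over a finite index set are well-founded, so a minimal size lies below that
  -- of the reduct; being listed by `m`, it consists of natural numbers.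
  obtain ⟨k, hk, hkmin⟩ := exists_minimal_le_of_wellFoundedLT
    (fun k' => ∃ A : Interpretation.{u} L₁, A.Models T₁ ∧ A.Satisfies Γ₁ ∧
      A.size (L₁.sorts ∩ L₂.sorts) = k') (A.size (L₁.sorts ∩ L₂.sorts))
    ⟨A, hI₁, (hΓ₁s A).2 (hlits.reduct _), rfl⟩
  have hkm : k ∈ Theory.minmods.{u} T₁ (L₁.sorts ∩ L₂.sorts) Γ₁ := hkmin
  rw [hm Γ₁ hΓ₁] at hkm
  obtain ⟨v, hv, rfl⟩ := hkm
  refine ⟨v, hv, ?_⟩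
  obtain ⟨Δ, hΔ, hΔc, hΔs⟩ := exists_code_eq_conjCode_refl.{u} hW₂ hs₂
    (distinctLits (sharedSort L₁ L₂) (Γ₂.code + 1) v)
  rw [← hΔc]
  have hshared : ∀ i, sharedSort L₁ L₂ i ∈ L₂.sorts := fun i =>
    (Finset.mem_inter.1 (sharedSort_mem i)).2
  have hfresh : ∀ s ∈ L₂.sorts, ∃ a : ℕ → I.str.carrier s, ∀ i, sharedSort L₁ L₂ i = s →
      ∀ j < v i, ∀ j' < j, a j ≠ a j' := by
    intro s hs
    have := I.str.carrier_nonempty s (Finset.mem_union_right _ hs)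
    by_cases hex : ∃ i, sharedSort L₁ L₂ i = s
    · obtain ⟨i, rfl⟩ := hex
      have hle : (v i : Cardinal.{u}) ≤ Cardinal.mk (I.str.carrier (sharedSort L₁ L₂ i)) := hk i
      obtain ⟨a, ha⟩ := exists_pairwise_ne_of_natCast_le hle
      refine ⟨a, fun i' hi' => ?_⟩
      rw [sharedSort_injective hi']
      exact ha
    · exact ⟨fun _ => this.some, fun i hi => absurd ⟨i, hi⟩ hex⟩
  choose a ha using hfresh
  let B : Structure.{u} L₂ := I.str.reduct (L₁.sub_union_right L₂)
  -- Variables up to `Γ₂.code` keep their values, so Γ₂ stays true; the later ones, shifted to start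
  -- at 0, enumerate the distinct elements.
  let μ : Assignment B := fun s hs i =>
    if i ≤ Γ₂.code then ν.reduct (L₁.sub_union_right L₂) s hs i else a s hs (i - (Γ₂.code + 1))
  refine (hD _).2 ⟨.and Γ₂ Δ, ⟨hΓ₂, hΔ⟩, rfl, ⟨B, μ⟩,
    Interpretation.models_congr_asg _ μ hI₂, ?_, ?_⟩
  · refine (Γ₂.realize_congr fun s hs i hi => ?_).2
      ((hΓ₂s ⟨B, ν.reduct _⟩).2 (hlits.reduct (L₁.sub_union_right L₂)))
    exact if_pos (Γ₂.le_code_of_mem_freeVars hi)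
  · refine (hΔs ⟨B, μ⟩).2 ((Interpretation.satisfiesLits_distinctLits_iff hshared).2 ?_)
    intro i j hj j' hj'
    have hμ : ∀ j, μ _ (hshared i) (Γ₂.code + 1 + j) = a _ (hshared i) j := by
      intro j
      have h1 : ¬ Γ₂.code + 1 + j ≤ Γ₂.code := by omega
      refine (if_neg h1).trans ?_
      rw [Nat.add_sub_cancel_left]
    simp only [hμ]
    exact ha _ (hshared i) i rfl j hj j' hj'

end Correctness

/-! ## The combination theorem -/

/-- A decision procedure for satisfiability in a consistent theory decides well-formedness. -/
theorem exists_isDecider {T : Theory L} (A : Interpretation.{u} L) (hA : A.Models T)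
    {D : ℕ → Bool} (hDc : Computable D)
    (hD : ∀ n, D n = true ↔ ∃ φ : Formula L, φ.IsQF ∧ φ.code = n ∧ T.Satisfiable.{u} φ) :
    ∃ W : ℕ → Bool, Computable W ∧ L.IsDecider W := by
  -- The number tested codes a tautology whenever c codes a quantifier-free formula, and the model
  -- `A` makes it satisfiable; otherwise it codes no quantifier-free formula at all.
  refine ⟨fun c => D (negCode (andCode c (negCode c))),
    hDc.comp (computable_negCode.comp (computable_andCode Computable.id computable_negCode)),
    fun c => ?_⟩
  rw [hD]
  constructor
  · rintro ⟨φ, hφ, hc, -⟩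
    cases φ <;> simp only [Formula.code, negCode, andCode, Nat.pair_eq_pair] at hc <;> try omega
    rename_i φ
    obtain ⟨-, hc⟩ := hc
    cases φ <;> simp only [Formula.code, Nat.pair_eq_pair] at hc <;> try omega
    rename_i φ ψ
    exact ⟨φ, hφ.1, hc.2.1⟩
  · rintro ⟨φ, hφ, rfl⟩
    exact ⟨.neg (.and φ (.neg φ)), ⟨hφ, hφ⟩, rfl, A, hA, fun h => h.2 h.1⟩

theorem Theory.QFSatDecidable.exists_bool {T : Theory L} (h : T.QFSatDecidable.{u}) :
    ∃ D : ℕ → Bool, Computable D ∧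
      ∀ n, D n = true ↔ ∃ φ : Formula L, φ.IsQF ∧ φ.code = n ∧ T.Satisfiable.{u} φ := by
  obtain ⟨hdec, h⟩ := h
  exact ⟨_, h, fun n => decide_eq_true_iff⟩

theorem Theory.QFSatDecidable.of_not_exists_models {T : Theory L}
    (h : ¬ ∃ A : Interpretation.{u} L, A.Models T) : T.QFSatDecidable.{u} := by
  refine (PrimrecPred.computablePred ⟨fun _ => isFalse id, Primrec.const false⟩ :
    ComputablePred fun _ : ℕ => False).of_eq fun n => ?_
  simp only [false_iff]
  rintro ⟨φ, -, -, A, hA, -⟩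
  exact h ⟨A, hA⟩

theorem Theory.QFSatDecidable.union (hdisj : L₁.IsDisjoint L₂) {T₁ : Theory L₁}
    {T₂ : Theory L₂} (hdec₁ : T₁.QFSatDecidable.{u}) (hdec₂ : T₂.QFSatDecidable.{u})
    (hfs : T₁.FinitelySmooth.{u} (L₁.sorts ∩ L₂.sorts))
    (hmm : T₁.MinmodsComputable.{u} (L₁.sorts ∩ L₂.sorts)) :
    (T₁.union T₂).QFSatDecidable.{u} := by
  -- The case split is not effective and need not be. A model of the union provides, by reducts,
  -- models of both theories, which the well-formedness deciders require.
  by_cases hT : ∃ A : Interpretation.{u} (L₁.union L₂), A.Models (T₁.union T₂)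
  swap
  · exact .of_not_exists_models hT
  obtain ⟨A, hA⟩ := hT
  obtain ⟨hA₁, hA₂⟩ := (Theory.models_union_iff A.str A.asg).1 hA
  obtain ⟨D₁, hD₁c, hD₁⟩ := hdec₁.exists_bool
  obtain ⟨D₂, hD₂c, hD₂⟩ := hdec₂.exists_bool
  obtain ⟨W₁, hW₁c, hW₁⟩ := exists_isDecider _ hA₁ hD₁c hD₁
  obtain ⟨W₂, hW₂c, hW₂⟩ := exists_isDecider _ hA₂ hD₂c hD₂
  obtain ⟨s₁, hs₁⟩ := L₁.sorts_nonempty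
  obtain ⟨s₂, hs₂⟩ := L₂.sorts_nonempty
  obtain ⟨m, hmc, hm⟩ := hmm
  have hc : Computable (decideUnion (L₁.union L₂) W₁ W₂ D₂ s₁ s₂ (sharedSort L₁ L₂) m) := by
    refine computable_decideUnion hW₁c hW₂c hD₂c
      -- A symbol belongs to the union exactly when its test formula is well-formed over one of the
      -- two signatures.
      (F := fun x => W₁ (testFun x) || W₂ (testFun x))
      (R := fun x => W₁ (testPred x) || W₂ (testPred x))
      (Primrec.or.to_comp.comp (hW₁c.comp computable_testFun) (hW₂c.comp computable_testFun))
      (fun f => ?_)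
      (Primrec.or.to_comp.comp (hW₁c.comp computable_testPred) (hW₂c.comp computable_testPred))
      (fun P => ?_) s₁ s₂ _ hmc
    · rw [Bool.or_eq_true, hW₁, hW₂, exists_code_eq_testFun, exists_code_eq_testFun]
      rfl
    · rw [Bool.or_eq_true, hW₁, hW₂, exists_code_eq_testPred, exists_code_eq_testPred]
      rfl
  refine (computable_bool_eq_true hc).of_eq fun n =>
    ⟨satisfiable_of_decideUnion hdisj hfs hW₁ hW₂ hs₁ hs₂ hD₂ hm, ?_⟩
  rintro ⟨φ, hφ, rfl, h⟩
  exact decideUnion_of_satisfiable hW₁ hW₂ hs₁ hs₂ hD₂ hm hφ h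

end ManySorted

theorem mainTheorem4 (L₁ L₂ : ManySorted.Signature) (hdisj : L₁.IsDisjoint L₂)
    (T₁ : ManySorted.Theory L₁) (T₂ : ManySorted.Theory L₂)
    (hdec₁ : ManySorted.Theory.QFSatDecidable.{u} T₁)
    (hdec₂ : ManySorted.Theory.QFSatDecidable.{u} T₂)
    (hsf : ManySorted.Theory.StablyFinite.{u} T₁ (L₁.sorts ∩ L₂.sorts))
    (hfs : ManySorted.Theory.FinitelySmooth.{u} T₁ (L₁.sorts ∩ L₂.sorts))
    (hmm : ManySorted.Theory.MinmodsComputable.{u} T₁ (L₁.sorts ∩ L₂.sorts)) :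
    ManySorted.Theory.QFSatDecidable.{u} (ManySorted.Theory.union T₁ T₂) :=
  ManySorted.Theory.QFSatDecidable.union hdisj hdec₁ hdec₂ hfs hmm
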